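/- Let $(\Omega,\mathcal S,\mu)$ be a non-atomic Lebesgue probability space (isomorphic modulo null sets, up to completion, to $[0,1]$ with Lebesgue measure), and let $T$ be an ergodic automorphism of it, i.e. a bi-measurable bijection of $\Omega$ that preserves $\mu$ and is ergodic. For a measurable $F:\Omega\to \mathrm{GL}_2(\mathbb R)$ put $F^{(0)}(\omega)=\mathrm{Id}$, $F^{(n)}(\omega)=F(T^{n-1}\omega)\cdots F(T\omega)F(\omega)$ and $F^{(-n)}(\omega)=F^{(n)}(T^{-n}\omega)^{-1}$ for $n>0$. The map $F$ is *bounded* if $F(\Omega)$ is relatively compact in $\mathrm{GL}_2(\mathbb R)$. The cocycle $(T,F)$ has *Lyapunov exponents* $r_1,r_2$ if for $\mu$-a.e. $\omega$ and $i=1,2$ one has $\frac1n\log \mathbf s_i(F^{(n)}(\omega))\to r_i$ as $n\to+\infty$, where $\mathbf s_1\ge \mathbf s_2$ are the singular values. For $r_1>r_2$ its *Oseledets spaces* are $$\mathbf E_i(\omega)=\Big\{v\in\mathbb R^2 : \lim_{n\to\pm\infty}\tfrac1n\log\|F^{(n)}(\omega)v\|=r_i \text{ or } v=0\Big\},\qquad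 i=1,2 .$$ Let $\mathsf X=\{(x_1,x_2)\in\mathbb{RP}^1\times\mathbb{RP}^1: x_1\ne x_2\}$. A Borel probability measure $\eta$ on $\mathsf X$ has *unbounded gap* if for every $\varepsilon>0$ there are Borel sets $A,B\subseteq \mathsf X$ with $\eta(A)>0$, $\eta(B)>0$, $\eta(A\cup B)=1$ and $\sin\angle(x_1,x_2)<\varepsilon\sin\angle(y_1,y_2)$ for all $(x_1,x_2)\in A$ and $(y_1,y_2)\in B$; otherwise $\eta$ has *bounded gap*. **Theorem.** Let $r_1>r_2$ be real numbers and let $\eta$ be a Borel probability measure on $\mathsf X$. If $\eta$ has bounded gap, then there exists a bounded measurable map $F:\Omega\to\mathrm{GL}_2(\mathbb R)$ such that the cocycle $(T,F)$ has Lyapunov exponents $r_1,r_2$ and its Oseledets spaces $\mathbf E_1,\mathbf E_2$ are lines with joint distribution $\eta$, that is, the push-forward of $\mu$ under $\omega\mapsto(\mathbf E_1(\omega),\mathbf E_2(\omega))$ (defined almost everywhere) is $\eta$. Conversely, if $F$ is a bounded measurable map such that $(T,F)$ has Lyapunov exponents $r_1,r_2$ and its Oseledets spaces are lines with joint distribution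 $\eta$, then $\eta$ has bounded gap. -/

import Mathlib

open MeasureTheory Filter Topology

noncomputable section

namespace Oseledets

/-! ### Lebesgue spaces -/

/-- `(Ω, μ)` is a non-atomic Lebesgue probability space: it is isomorphic modulo null sets to the
unit interval with Lebesgue measure.  The two maps `φ`, `ψ` are measurable up to null sets, preserve
measure, and are mutually inverse almost everywhere.  Both the complete spaces, such as `[0,1]`
with the Lebesgue `σ`-algebra, and the spaces whose completion is of this type, such as `[0,1]`
with the Borel `σ`-algebra, are included. -/
def IsNonatomicLebesgueSpace {Ω : Type*} [MeasurableSpace Ω] (μ : Measure Ω) : Prop :=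
  ∃ (φ : Ω → unitInterval) (ψ : unitInterval → Ω),
    NullMeasurable φ μ ∧ NullMeasurable ψ (volume : Measure unitInterval) ∧
    (∀ s : Set unitInterval, MeasurableSet s → μ (φ ⁻¹' s) = volume s) ∧
    (∀ s : Set Ω, MeasurableSet s → volume (ψ ⁻¹' s) = μ s) ∧
    (∀ᵐ ω ∂μ, ψ (φ ω) = ω) ∧
    (∀ᵐ t ∂(volume : Measure unitInterval), φ (ψ t) = t)

/-! ### Pairs of distinct lines in the plane -/

/-- The Euclidean plane `ℝ²`. -/
abbrev Plane : Type := EuclideanSpace ℝ (Fin 2)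

/-- The real projective line: the lines through the origin of `ℝ²`. -/
def RP1 : Type := Projectivization ℝ Plane

/-- The quotient topology of `ℝ² \ {0}`. -/
instance : TopologicalSpace RP1 :=
  TopologicalSpace.coinduced (Projectivization.mk' ℝ : {v : Plane // v ≠ 0} → RP1) inferInstance

/-- A point of `RP1`, seen as a linear subspace of the plane. -/
def RP1.line (x : RP1) : Submodule ℝ Plane :=
  Projectivization.submodule (K := ℝ) (V := Plane) x

/-- A nonzero vector on the line `x`. -/
def RP1.dir (x : RP1) : Plane :=
  Projectivization.rep (K := ℝ) (V := Plane) x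

/-- The angle, in `[0, π/2]`, between two lines; it does not depend on the vectors that represent
the lines. -/
def RP1.angle (x y : RP1) : ℝ :=
  min (InnerProductGeometry.angle x.dir y.dir) (Real.pi - InnerProductGeometry.angle x.dir y.dir)

/-- The space of ordered pairs of distinct lines, with the topology induced by the product
topology. -/
abbrev LinePairs : Type := {p : RP1 × RP1 // p.1 ≠ p.2}

instance : MeasurableSpace LinePairs := borel LinePairs

instance : BorelSpace LinePairs := ⟨rfl⟩

/-- The angle between the two lines of a pair. -/
def pairAngle (p : LinePairs) : ℝ := RP1.angle p.1.1 p.1.2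

/-- The measure `η` has unbounded gap. -/
def HasUnboundedGap (η : Measure LinePairs) : Prop :=
  ∀ ε : ℝ, 0 < ε → ∃ A B : Set LinePairs, MeasurableSet A ∧ MeasurableSet B ∧
    0 < η A ∧ 0 < η B ∧ η (A ∪ B) = 1 ∧
    ∀ x ∈ A, ∀ y ∈ B, Real.sin (pairAngle x) < ε * Real.sin (pairAngle y)

/-- The measure `η` has bounded gap. -/
def HasBoundedGap (η : Measure LinePairs) : Prop := ¬ HasUnboundedGap η

/-! ### Linear cocycles -/

/-- The action of a matrix on the Euclidean plane. -/
def act (g : GL (Fin 2) ℝ) : Plane →ₗ[ℝ] Plane :=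
  Matrix.toEuclideanLin (g : Matrix (Fin 2) (Fin 2) ℝ)

variable {Ω : Type*} [MeasurableSpace Ω]

/-- For `n : ℕ`, the product `F (T^(n-1) ω) ⋯ F (T ω) F ω`. -/
def forwardProduct (T : Ω ≃ᵐ Ω) (F : Ω → GL (Fin 2) ℝ) : ℕ → Ω → GL (Fin 2) ℝ
  | 0, _ => 1
  | n + 1, ω => F (T^[n] ω) * forwardProduct T F n ω

/-- The products `F^(n)(ω)` of the linear cocycle `(T, F)`, for `n : ℤ`; for `n > 0`,
`F^(-n)(ω)` is the inverse of `F^(n)(T^(-n) ω)`. -/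
def cocycle (T : Ω ≃ᵐ Ω) (F : Ω → GL (Fin 2) ℝ) : ℤ → Ω → GL (Fin 2) ℝ
  | Int.ofNat n, ω => forwardProduct T F n ω
  | Int.negSucc n, ω => (forwardProduct T F (n + 1) (T.symm^[n + 1] ω))⁻¹

/-- The map `F` is bounded: its image is relatively compact in `GL₂(ℝ)`. -/
def IsBoundedMap (F : Ω → GL (Fin 2) ℝ) : Prop :=
  IsCompact (closure (Set.range F))

/-- The cocycle `(T, F)` has Lyapunov exponents `r₁, r₂`: these numbers are, almost everywhere,
the exponential growth rates of the first and of the second singular value of `F^(n)(ω)`. -/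
def HasLyapunovExponents (μ : Measure Ω) (T : Ω ≃ᵐ Ω) (F : Ω → GL (Fin 2) ℝ) (r₁ r₂ : ℝ) : Prop :=
  ∀ᵐ ω ∂μ,
    Tendsto (fun n : ℕ => 1 / (n : ℝ) * Real.log ((act (cocycle T F n ω)).singularValues 0))
      atTop (𝓝 r₁) ∧
    Tendsto (fun n : ℕ => 1 / (n : ℝ) * Real.log ((act (cocycle T F n ω)).singularValues 1))
      atTop (𝓝 r₂)

/-- The Oseledets space at `ω` for the exponent `r`: the vectors `v` that vanish or satisfy
`(1/n) log ‖F^(n)(ω) v‖ → r` as `n → +∞` and as `n → -∞`. -/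
def oseledetsSpace (T : Ω ≃ᵐ Ω) (F : Ω → GL (Fin 2) ℝ) (r : ℝ) (ω : Ω) : Set Plane :=
  {v | Tendsto (fun n : ℤ => 1 / (n : ℝ) * Real.log ‖act (cocycle T F n ω) v‖)
    (atTop ⊔ atBot) (𝓝 r) ∨ v = 0}

/-- The Oseledets spaces of `(T, F)` for the exponents `r₁, r₂` are almost everywhere two distinct
lines, which depend measurably on the point and have joint distribution `η`. -/
def OseledetsJointDistribution (μ : Measure Ω) (T : Ω ≃ᵐ Ω) (F : Ω → GL (Fin 2) ℝ) (r₁ r₂ : ℝ)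
    (η : Measure LinePairs) : Prop :=
  ∃ E : Ω → LinePairs, Measurable E ∧
    (∀ᵐ ω ∂μ, ((E ω).1.1.line : Set Plane) = oseledetsSpace T F r₁ ω ∧
      ((E ω).1.2.line : Set Plane) = oseledetsSpace T F r₂ ω) ∧
    μ.map E = η

end Oseledets

end

/-! The link between both directions is the formula sin∠(Av, Aw) · |Av| |Aw| = |det A| · sin∠(v, w)
for unit vectors v, w. A bounded cocycle that carries a pair of lines along an orbit changes the
sine of their angle by a bounded factor at each step.

Necessity (`hasBoundedGap_of_oseledetsJointDistribution`): Oseledets spaces are equivariant, so the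
sine of their angle cannot fall by more than a fixed factor in one step. If the values of the sine
had a gap wider than this factor, an orbit could never pass from above the gap to below it. The
points above the gap would then form an invariant set modulo null sets, of measure neither 0 nor 1,
against ergodicity.

Sufficiency has two halves. The first (`exists_linePairs_of_hasBoundedGap`) finds E : Ω →
`LinePairs` with law η whose angles change by a bounded factor along orbits. Bounded gap makes the
measures q k of the sets Q k = {sin ≤ a ρ^k} strictly decreasing, unless the angles are bounded
below, when there is nothing to control. The slack q k - q (k+1) leaves room for sets G k in Ω with
T^{±1} G (k+1) ⊆ G k and q (k+1) ≤ μ (G k) ≤ q k (`exists_nested_sets`). They are unions of sublevel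
sets of functions that are constant along long stretches of orbit, enlarged by orbit neighborhoods
of the small sets where these functions jump. A monotone transport (`exists_map_eq_monotone`) sends
G k into Q k and pulls Q (k+1) back into G k, so one step of T moves the level of the angle by at
most two.

The second half (`exists_cocycle_with_exponents`) lets F map the unit vectors of E ω to multiples of
those of E (T ω). Unequal stretching of two nearly parallel lines would need a large matrix. The
factors are therefore 1 where the angle is small, and constants on a set P of positive measure where
it is not; dividing the desired exponents by μ P corrects the averages. Birkhoff's theorem gives the
growth along each line in both time directions, and these lines are then the Oseledets spaces. The
determinant involves also the quotient of the sines at the two ends of the orbit, whose logarithm is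
o(n) by recurrence (`ae_tendsto_coboundary`); this yields the second singular value. -/

noncomputable section

namespace Oseledets

/-! ### Birkhoff's ergodic theorem for bounded functions -/

section Birkhoff

variable {α : Type*} {T : α → α} {g : α → ℝ}

/-- The maximum of `0` and of the Birkhoff sums of length at most `n`. -/
def birkhoffMax (T : α → α) (g : α → ℝ) : ℕ → α → ℝ
  | 0, _ => 0
  | n + 1, x => max 0 (g x + birkhoffMax T g n (T x))

lemma birkhoffMax_nonneg (n : ℕ) (x : α) : 0 ≤ birkhoffMax T g n x := by
  cases n <;> simp [birkhoffMax]

lemma birkhoffMax_le_succ (n : ℕ) (x : α) : birkhoffMax T g n x ≤ birkhoffMax T g (n + 1) x := by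
  induction n generalizing x with
  | zero => simp [birkhoffMax]
  | succ n ih =>
    rw [birkhoffMax, birkhoffMax]
    have := ih (T x)
    gcongr

lemma birkhoffMax_mono {m n : ℕ} (h : m ≤ n) (x : α) :
    birkhoffMax T g m x ≤ birkhoffMax T g n x :=
  monotone_nat_of_le_succ (f := fun n => birkhoffMax T g n x)
    (fun n => birkhoffMax_le_succ n x) h

lemma birkhoffSum_le_birkhoffMax (n : ℕ) (x : α) : birkhoffSum T g n x ≤ birkhoffMax T g n x := by
  induction n generalizing x with
  | zero => simp [birkhoffMax]
  | succ n ih =>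
    rw [birkhoffSum_succ', birkhoffMax]
    exact le_max_of_le_right (by linarith [ih (T x)])

lemma birkhoffMax_le {C : ℝ} (hC : 0 ≤ C) (hgC : ∀ x, |g x| ≤ C) (n : ℕ) (x : α) :
    birkhoffMax T g n x ≤ n * C := by
  induction n generalizing x with
  | zero => simp [birkhoffMax]
  | succ n ih =>
    rw [birkhoffMax]
    refine max_le (by positivity) ?_
    push_cast
    linarith [ih (T x), (abs_le.1 (hgC x)).2]

variable [MeasurableSpace α] {μ : Measure α}

lemma measurable_birkhoffMax (hT : Measurable T) (hg : Measurable g) (n : ℕ) :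
    Measurable (birkhoffMax T g n) := by
  induction n with
  | zero => exact measurable_const
  | succ n ih => exact measurable_const.max (hg.add (ih.comp hT))

/-- The maximal ergodic theorem. -/
lemma integral_nonneg_of_birkhoffMax_pos [IsFiniteMeasure μ] (hT : MeasurePreserving T μ μ)
    (hg : Measurable g) {C : ℝ} (hgC : ∀ x, |g x| ≤ C)
    (hpos : ∀ᵐ x ∂μ, ∃ n, 0 < birkhoffSum T g n x) : 0 ≤ ∫ x, g x ∂μ := by
  rcases isEmpty_or_nonempty α with h | ⟨⟨x₀⟩⟩
  · simp [integral_of_isEmpty]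
  have hC : 0 ≤ C := (abs_nonneg _).trans (hgC x₀)
  have hMm := measurable_birkhoffMax hT.measurable hg
  have hMi : ∀ n, Integrable (birkhoffMax T g n) μ := fun n =>
    Integrable.of_bound (hMm n).aestronglyMeasurable (n * C) (Eventually.of_forall fun x => by
      rw [Real.norm_of_nonneg (birkhoffMax_nonneg n x)]
      exact birkhoffMax_le hC hgC n x)
  let A : ℕ → Set α := fun n => {x | 0 < birkhoffMax T g (n + 1) x}
  have hA : ∀ n, MeasurableSet (A n) := fun n => measurableSet_lt measurable_const (hMm _)
  have hgi : Integrable g μ := Integrable.of_bound hg.aestronglyMeasurable C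
    (Eventually.of_forall hgC)
  -- Write M n for `birkhoffMax T g n`. On A n, g = M (n+1) - M n ∘ T ≥ M (n+1) - M (n+1) ∘ T; off A
  -- n the last difference is at most 0. Its integral vanishes because T preserves μ.
  have key : ∀ n, 0 ≤ ∫ x, (A n).indicator g x ∂μ := by
    intro n
    have h1 : ∫ x, (birkhoffMax T g (n + 1) x - birkhoffMax T g (n + 1) (T x)) ∂μ = 0 := by
      have hi : Integrable (fun x => birkhoffMax T g (n + 1) (T x)) μ :=
        hT.integrable_comp_of_integrable (hMi _)
      rw [integral_sub (hMi _) hi,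
        ← integral_map hT.aemeasurable (by rw [hT.map_eq]; exact (hMm _).aestronglyMeasurable),
        hT.map_eq, sub_self]
    rw [← h1]
    refine integral_mono ((hMi _).sub (hT.integrable_comp_of_integrable (hMi _)))
      (hgi.indicator (hA n)) fun x => ?_
    by_cases hx : x ∈ A n
    · rw [Set.indicator_of_mem hx]
      have hx' : 0 < birkhoffMax T g (n + 1) x := hx
      have h2 : birkhoffMax T g (n + 1) x = g x + birkhoffMax T g n (T x) := by
        rw [birkhoffMax] at hx' ⊢
        rcases lt_max_iff.1 hx' with h | h
        · exact absurd h (lt_irrefl _)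
        · exact max_eq_right h.le
      have := birkhoffMax_le_succ (T := T) (g := g) n (T x)
      linarith
    · rw [Set.indicator_of_notMem hx]
      have h2 : birkhoffMax T g (n + 1) x ≤ 0 := not_lt.1 hx
      have := birkhoffMax_nonneg (T := T) (g := g) (n + 1) (T x)
      linarith
  have hlim : Tendsto (fun n => ∫ x, (A n).indicator g x ∂μ) atTop (𝓝 (∫ x, g x ∂μ)) := by
    refine tendsto_integral_of_dominated_convergence (fun _ => C)
      (fun n => (hg.indicator (hA n)).aestronglyMeasurable) (integrable_const C) ?_ ?_
    · refine fun n => Eventually.of_forall fun x => ?_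
      exact (norm_indicator_le_norm_self _ _).trans (hgC x)
    · filter_upwards [hpos] with x hx
      obtain ⟨n, hn⟩ := hx
      refine tendsto_const_nhds.congr' ?_
      filter_upwards [eventually_ge_atTop n] with m hm
      rw [Set.indicator_of_mem]
      exact hn.trans_le ((birkhoffSum_le_birkhoffMax n x).trans (birkhoffMax_mono (by omega) x))
  exact ge_of_tendsto' hlim key

lemma measurable_birkhoffSum (hT : Measurable T) (hg : Measurable g) (n : ℕ) :
    Measurable (birkhoffSum T g n) :=
  Finset.measurable_fun_sum _ fun k _ => hg.comp (hT.iterate k)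

/-- The set where the sums are unbounded above is invariant, since the sums from x and from T x
differ by g x after a shift. If it had full measure, the maximal ergodic theorem would make the
integral nonnegative. -/
lemma ae_bddAbove_birkhoffSum [IsProbabilityMeasure μ] (hT : Ergodic T μ)
    (hg : Measurable g) {C : ℝ} (hgC : ∀ x, |g x| ≤ C) (hneg : ∫ x, g x ∂μ < 0) :
    ∀ᵐ x ∂μ, ∃ N : ℕ, ∀ n, birkhoffSum T g n x ≤ N := by
  let U : Set α := {x | ∀ N : ℕ, ∃ n, (N : ℝ) < birkhoffSum T g n x}
  have hU : MeasurableSet U := by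
    have : U = ⋂ N : ℕ, ⋃ n, {x | (N : ℝ) < birkhoffSum T g n x} := by ext; simp [U]
    rw [this]
    exact MeasurableSet.iInter fun N => MeasurableSet.iUnion fun n =>
      measurableSet_lt measurable_const (measurable_birkhoffSum hT.measurable hg n)
  have hinv : T ⁻¹' U = U := by
    ext x
    obtain ⟨K, hK⟩ := exists_nat_ge |g x|
    have hK' := abs_le.1 hK
    constructor
    · intro hx N
      obtain ⟨n, hn⟩ := hx (N + K)
      refine ⟨n + 1, ?_⟩
      rw [birkhoffSum_succ']
      push_cast at hn
      linarith
    · intro hx N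
      obtain ⟨n, hn⟩ := hx (N + K)
      push_cast at hn
      cases n with
      | zero =>
        simp only [birkhoffSum_zero] at hn
        exact absurd hn (by push Not; positivity)
      | succ n =>
        refine ⟨n, ?_⟩
        rw [birkhoffSum_succ'] at hn
        linarith
  rcases hT.toPreErgodic.ae_empty_or_univ hU hinv with h | h
  · have : ∀ᵐ x ∂μ, x ∉ U := by
      filter_upwards [h] with x hx hxU
      exact (iff_of_eq hx).1 hxU
    filter_upwards [this] with x hx
    simpa [U] using hx
  · refine absurd hneg (not_lt.2 ?_)
    refine integral_nonneg_of_birkhoffMax_pos hT.toMeasurePreserving hg hgC ?_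
    filter_upwards [h] with x hx
    have hxU : x ∈ U := (iff_of_eq hx).2 trivial
    simpa using hxU 0

/-- For b strictly between the integral and a, the sums of g - b are bounded above, and n (a - b)
eventually exceeds the bound. -/
lemma ae_eventually_birkhoffSum_le [IsProbabilityMeasure μ] (hT : Ergodic T μ)
    (hg : Measurable g) {C : ℝ} (hgC : ∀ x, |g x| ≤ C) {a : ℝ} (ha : ∫ x, g x ∂μ < a) :
    ∀ᵐ x ∂μ, ∀ᶠ n : ℕ in atTop, 1 / (n : ℝ) * birkhoffSum T g n x ≤ a := by
  obtain ⟨b, hb, hba⟩ := exists_between ha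
  have hgi : Integrable g μ := Integrable.of_bound hg.aestronglyMeasurable C
    (Eventually.of_forall hgC)
  have h := ae_bddAbove_birkhoffSum (g := fun x => g x - b) (C := C + |b|) hT
    (hg.sub_const b) (fun x => (abs_sub _ _).trans (by linarith [hgC x]))
    (by rw [integral_sub hgi (integrable_const b)]; simpa using hb)
  filter_upwards [h] with x ⟨N, hN⟩
  obtain ⟨K, hK⟩ := exists_nat_gt ((N : ℝ) / (a - b))
  filter_upwards [eventually_ge_atTop (K + 1)] with n hn
  have h1 : birkhoffSum T (fun x => g x - b) n x = birkhoffSum T g n x - n * b := by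
    simp [birkhoffSum, Finset.sum_sub_distrib]
  have h2 := hN n
  rw [h1] at h2
  have hn0 : (0 : ℝ) < n := by exact_mod_cast (by omega : 0 < n)
  rw [one_div, inv_mul_le_iff₀ hn0]
  have h3 : (N : ℝ) < K * (a - b) := (div_lt_iff₀ (by linarith)).1 hK
  have h4 : (K : ℝ) ≤ n := by exact_mod_cast (by omega : K ≤ n)
  nlinarith

/-- Birkhoff's ergodic theorem for a bounded measurable function. -/
theorem ae_tendsto_birkhoffSum [IsProbabilityMeasure μ] (hT : Ergodic T μ)
    (hg : Measurable g) {C : ℝ} (hgC : ∀ x, |g x| ≤ C) :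
    ∀ᵐ x ∂μ, Tendsto (fun n : ℕ => 1 / (n : ℝ) * birkhoffSum T g n x) atTop
      (𝓝 (∫ x, g x ∂μ)) := by
  have hup : ∀ᵐ x ∂μ, ∀ k : ℕ, ∀ᶠ n : ℕ in atTop,
      1 / (n : ℝ) * birkhoffSum T g n x ≤ ∫ x, g x ∂μ + 1 / ((k : ℝ) + 1) :=
    ae_all_iff.2 fun k => ae_eventually_birkhoffSum_le hT hg hgC
      (lt_add_of_pos_right _ (by positivity))
  have hlow : ∀ᵐ x ∂μ, ∀ k : ℕ, ∀ᶠ n : ℕ in atTop,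
      1 / (n : ℝ) * birkhoffSum T (-g) n x ≤ -∫ x, g x ∂μ + 1 / ((k : ℝ) + 1) := by
    refine ae_all_iff.2 fun k => ae_eventually_birkhoffSum_le hT hg.neg (C := C)
      (fun x => by simpa using hgC x) ?_
    rw [show (∫ x, (-g) x ∂μ) = -∫ x, g x ∂μ from integral_neg g]
    exact lt_add_of_pos_right _ (by positivity)
  filter_upwards [hup, hlow] with x h1 h2
  rw [Metric.tendsto_atTop']
  intro ε hε
  obtain ⟨k, hk⟩ := exists_nat_one_div_lt hε
  obtain ⟨N, hN⟩ := eventually_atTop.1 ((h1 k).and (h2 k))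
  refine ⟨N, fun n hn => ?_⟩
  have h3 := (hN n hn.le).1
  have h4 := (hN n hn.le).2
  rw [birkhoffSum_neg] at h4
  rw [Real.dist_eq, abs_lt]
  constructor <;> linarith

end Birkhoff

/-! ### The projective line and pairs of distinct lines -/

/-- The determinant of two vectors of the plane. -/
def wedge (v w : Plane) : ℝ := v 0 * w 1 - v 1 * w 0

lemma norm_sq_plane (v : Plane) : ‖v‖ ^ 2 = v 0 ^ 2 + v 1 ^ 2 := by
  rw [EuclideanSpace.real_norm_sq_eq, Fin.sum_univ_two]

lemma inner_plane (v w : Plane) : inner ℝ v w = v 0 * w 0 + v 1 * w 1 := by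
  rw [PiLp.inner_apply, Fin.sum_univ_two]
  simp [mul_comm]

lemma sq_add_sq_pos {v : Plane} (hv : v ≠ 0) : 0 < v 0 ^ 2 + v 1 ^ 2 := by
  rw [← norm_sq_plane]
  have := norm_pos_iff.2 hv
  positivity

/-- The cosine and the sine of twice the argument of a nonzero vector. -/
def doubleAngle (v : Plane) : ℝ × ℝ :=
  ((v 0 ^ 2 - v 1 ^ 2) / (v 0 ^ 2 + v 1 ^ 2), 2 * v 0 * v 1 / (v 0 ^ 2 + v 1 ^ 2))

lemma doubleAngle_smul {a : ℝ} (ha : a ≠ 0) (v : Plane) :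
    doubleAngle (a • v) = doubleAngle v := by
  have h1 : (a • v) 0 = a * v 0 := rfl
  have h2 : (a • v) 1 = a * v 1 := rfl
  have ha2 : a ^ 2 ≠ 0 := pow_ne_zero _ ha
  simp only [doubleAngle, h1, h2, Prod.mk.injEq]
  have h3 : (a * v 0) ^ 2 + (a * v 1) ^ 2 = a ^ 2 * (v 0 ^ 2 + v 1 ^ 2) := by ring
  rw [h3]
  constructor
  · rw [← mul_div_mul_left _ (v 0 ^ 2 + v 1 ^ 2) ha2]; ring_nf
  · rw [← mul_div_mul_left _ (v 0 ^ 2 + v 1 ^ 2) ha2]; ring_nf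

lemma wedge_eq_zero_of_doubleAngle_eq {v w : Plane} (hv : v ≠ 0) (hw : w ≠ 0)
    (h : doubleAngle v = doubleAngle w) : wedge v w = 0 := by
  have hv' := (sq_add_sq_pos hv).ne'
  have hw' := (sq_add_sq_pos hw).ne'
  simp only [doubleAngle, Prod.mk.injEq] at h
  obtain ⟨h1, h2⟩ := h
  rw [div_eq_div_iff hv' hw'] at h1 h2
  -- Up to the factor 4, this is the squared distance of the two double-angle vectors after clearing
  -- denominators: sin² θ = (1 - cos 2θ) / 2.
  have h3 : wedge v w ^ 2 * ((v 0 ^ 2 + v 1 ^ 2) * (w 0 ^ 2 + w 1 ^ 2)) = 0 := by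
    unfold wedge
    linear_combination
      ((v 0 ^ 2 - v 1 ^ 2) * (w 0 ^ 2 + w 1 ^ 2) - (w 0 ^ 2 - w 1 ^ 2) * (v 0 ^ 2 + v 1 ^ 2)) /
          4 * h1 +
        (2 * v 0 * v 1 * (w 0 ^ 2 + w 1 ^ 2) - 2 * w 0 * w 1 * (v 0 ^ 2 + v 1 ^ 2)) / 4 * h2
  rcases mul_eq_zero.1 h3 with h | h
  · exact pow_eq_zero_iff (two_ne_zero) |>.1 h
  · exact absurd h (mul_ne_zero hv' hw')

/-- The double angle of a line. -/
def RP1.double (x : RP1) : ℝ × ℝ := doubleAngle x.dir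

lemma RP1.dir_ne_zero (x : RP1) : x.dir ≠ 0 := Projectivization.rep_nonzero (K := ℝ) (V := Plane) x

lemma RP1.double_mk' (v : {v : Plane // v ≠ 0}) :
    RP1.double (Projectivization.mk' ℝ v : Projectivization ℝ Plane) = doubleAngle v := by
  obtain ⟨a, ha⟩ := Projectivization.exists_smul_eq_mk_rep ℝ v.1 v.2
  have : RP1.dir (Projectivization.mk' ℝ v : Projectivization ℝ Plane) = (a : ℝ) • v.1 := ha.symm
  exact (congrArg doubleAngle this).trans (doubleAngle_smul a.ne_zero _)

lemma RP1.continuous_double : Continuous RP1.double := by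
  refine continuous_coinduced_dom.2 ?_
  have : RP1.double ∘ (Projectivization.mk' ℝ : {v : Plane // v ≠ 0} → RP1) =
      fun v => doubleAngle v.1 := funext RP1.double_mk'
  rw [this]
  have h : ∀ v : {v : Plane // v ≠ 0}, v.1 0 ^ 2 + v.1 1 ^ 2 ≠ 0 :=
    fun v => (sq_add_sq_pos v.2).ne'
  have h0 : Continuous fun v : {v : Plane // v ≠ 0} => v.1 0 := by fun_prop
  have h1 : Continuous fun v : {v : Plane // v ≠ 0} => v.1 1 := by fun_prop
  exact (((h0.pow 2).sub (h1.pow 2)).div ((h0.pow 2).add (h1.pow 2)) h).prodMk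
    (((h0.const_mul 2).mul h1).div ((h0.pow 2).add (h1.pow 2)) h)

lemma RP1.eq_of_wedge_dir {x y : RP1} (h : wedge x.dir y.dir = 0) : x = y := by
  have hx := x.dir_ne_zero
  have hy := y.dir_ne_zero
  have h1 : Projectivization.mk ℝ x.dir hx = Projectivization.mk ℝ y.dir hy := by
    rw [Projectivization.mk_eq_mk_iff']
    refine ⟨(x.dir 0 * y.dir 0 + x.dir 1 * y.dir 1) / (y.dir 0 ^ 2 + y.dir 1 ^ 2), ?_⟩
    have hy' := (sq_add_sq_pos hy).ne'
    unfold wedge at h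
    ext i
    fin_cases i
    · change _ / _ * y.dir 0 = x.dir 0
      field_simp
      linear_combination (-y.dir 1) * h
    · change _ / _ * y.dir 1 = x.dir 1
      field_simp
      linear_combination (y.dir 0) * h
  have hxx : Projectivization.mk ℝ x.dir hx = x := Projectivization.mk_rep (K := ℝ) (V := Plane) x
  have hyy : Projectivization.mk ℝ y.dir hy = y := Projectivization.mk_rep (K := ℝ) (V := Plane) y
  exact hxx.symm.trans (h1.trans hyy)

lemma RP1.double_injective : Function.Injective RP1.double := fun x y h =>
  RP1.eq_of_wedge_dir (wedge_eq_zero_of_doubleAngle_eq x.dir_ne_zero y.dir_ne_zero h)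

instance : T2Space RP1 := T2Space.of_injective_continuous RP1.double_injective
  RP1.continuous_double

instance : CompactSpace RP1 := by
  let f : Metric.sphere (0 : Plane) 1 → RP1 := fun v =>
    Projectivization.mk' ℝ ⟨v.1, fun h => by have := v.2; simp [h] at this⟩
  let q : {v : Plane // v ≠ 0} → RP1 := fun v => Projectivization.mk' ℝ v
  have hq : Continuous q := continuous_coinduced_rng
  have hf : Continuous f := hq.comp (Continuous.subtype_mk continuous_subtype_val _)
  have hs : Function.Surjective f := by
    intro x
    have hx := x.dir_ne_zero
    have hx' : ‖x.dir‖ ≠ 0 := norm_ne_zero_iff.2 hx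
    refine ⟨⟨‖x.dir‖⁻¹ • x.dir, by simp [norm_smul, hx']⟩, ?_⟩
    change Projectivization.mk ℝ (‖x.dir‖⁻¹ • x.dir) (smul_ne_zero (inv_ne_zero hx') hx) = x
    conv_rhs => rw [← (Projectivization.mk_rep (K := ℝ) (V := Plane) x)]
    exact (Projectivization.mk_eq_mk_iff' ℝ _ _ _ _).2 ⟨‖x.dir‖⁻¹, rfl⟩
  have : CompactSpace (Metric.sphere (0 : Plane) 1) :=
    isCompact_iff_compactSpace.1 (isCompact_sphere _ _)
  exact hs.compactSpace hf

/-- The double angle embeds the compact projective line as a closed subset of ℝ². Polishness makes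
`LinePairs` a standard Borel space, which can be coded by real numbers and so reached by transport
on the line. -/
instance : PolishSpace RP1 :=
  (RP1.continuous_double.isClosedEmbedding RP1.double_injective).polishSpace

instance : PolishSpace LinePairs :=
  IsOpen.polishSpace (s := {p : RP1 × RP1 | p.1 ≠ p.2})
    (isOpen_ne_fun continuous_fst continuous_snd)

/-! ### Measurable unit vectors -/

/-- The unit vector on the line with the given double angle. -/
def unitOfDouble (c : ℝ × ℝ) : Plane :=
  -- (1 + cos 2θ, sin 2θ) = 2 cos θ · (cos θ, sin θ) spans the line of angle θ, except for the
  -- vertical line, where it vanishes. Unlike `RP1.dir`, this choice of vector is visibly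
  -- measurable.
  if 1 + c.1 = 0 then !₂[0, 1]
  else !₂[(1 + c.1) / √((1 + c.1) ^ 2 + c.2 ^ 2), c.2 / √((1 + c.1) ^ 2 + c.2 ^ 2)]

lemma measurable_unitOfDouble : Measurable unitOfDouble := by
  refine Measurable.ite (measurableSet_eq_fun (by fun_prop) (by fun_prop)) measurable_const ?_
  refine (WithLp.measurable_toLp 2 _).comp (measurable_pi_iff.2 fun i => ?_)
  fin_cases i
  · change Measurable fun c : ℝ × ℝ => (1 + c.1) / √((1 + c.1) ^ 2 + c.2 ^ 2)
    fun_prop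
  · change Measurable fun c : ℝ × ℝ => c.2 / √((1 + c.1) ^ 2 + c.2 ^ 2)
    fun_prop

/-- A unit vector on the line `x`. -/
def RP1.unit (x : RP1) : Plane := unitOfDouble x.double

lemma norm_unitOfDouble (c : ℝ × ℝ) : ‖unitOfDouble c‖ = 1 := by
  have h : ‖unitOfDouble c‖ ^ 2 = 1 := by
    rw [norm_sq_plane, unitOfDouble]
    split_ifs with h
    · simp
    · have hp : 0 < (1 + c.1) ^ 2 + c.2 ^ 2 := by positivity
      change ((1 + c.1) / √((1 + c.1) ^ 2 + c.2 ^ 2)) ^ 2 +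
        (c.2 / √((1 + c.1) ^ 2 + c.2 ^ 2)) ^ 2 = 1
      rw [div_pow, div_pow, Real.sq_sqrt hp.le, ← add_div, div_self hp.ne']
  nlinarith [norm_nonneg (unitOfDouble c)]

lemma RP1.norm_unit (x : RP1) : ‖x.unit‖ = 1 := norm_unitOfDouble _

lemma RP1.exists_smul_dir (x : RP1) : ∃ a : ℝ, x.unit = a • x.dir := by
  have hv := sq_add_sq_pos x.dir_ne_zero
  set v := x.dir
  have h1 : 1 + x.double.1 = 2 * v 0 / (v 0 ^ 2 + v 1 ^ 2) * v 0 := by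
    change 1 + (v 0 ^ 2 - v 1 ^ 2) / (v 0 ^ 2 + v 1 ^ 2) = _
    field_simp
    ring
  have h2 : x.double.2 = 2 * v 0 / (v 0 ^ 2 + v 1 ^ 2) * v 1 := by
    change 2 * v 0 * v 1 / (v 0 ^ 2 + v 1 ^ 2) = _
    field_simp
  rw [RP1.unit, unitOfDouble]
  split_ifs with h
  · have h0 : v 0 = 0 := by
      rw [h1] at h
      field_simp at h
      simpa using h
    rw [h0] at hv
    have hv1 : v 1 ≠ 0 := fun h => by simp [h] at hv
    refine ⟨(v 1)⁻¹, ?_⟩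
    ext i
    fin_cases i
    · change (0 : ℝ) = (v 1)⁻¹ * v 0
      simp [h0]
    · change (1 : ℝ) = (v 1)⁻¹ * v 1
      field_simp
  · refine ⟨2 * v 0 / (v 0 ^ 2 + v 1 ^ 2) / √((1 + x.double.1) ^ 2 + x.double.2 ^ 2), ?_⟩
    ext i
    fin_cases i
    · generalize √((1 + x.double.1) ^ 2 + x.double.2 ^ 2) = r
      change (1 + x.double.1) / r = _ / r * v 0
      conv_lhs => rw [h1]
      ring
    · generalize √((1 + x.double.1) ^ 2 + x.double.2 ^ 2) = r
      change x.double.2 / r = _ / r * v 1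
      conv_lhs => rw [h2]
      ring

lemma RP1.exists_dir_eq (x : RP1) : ∃ a : ℝ, x.dir = a • x.unit ∧ |a| = ‖x.dir‖ := by
  obtain ⟨a, ha⟩ := x.exists_smul_dir
  have hu := x.norm_unit
  have ha0 : a ≠ 0 := by
    rintro rfl
    rw [ha] at hu
    simp at hu
  have h : x.dir = a⁻¹ • x.unit := by rw [ha, smul_smul, inv_mul_cancel₀ ha0, one_smul]
  refine ⟨a⁻¹, h, ?_⟩
  conv_rhs => rw [h, norm_smul, hu, mul_one, Real.norm_eq_abs]

lemma RP1.mem_line_iff (x : RP1) (w : Plane) : w ∈ x.line ↔ ∃ a : ℝ, w = a • x.unit := by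
  have h : x.line = Submodule.span ℝ {x.dir} :=
    Projectivization.submodule_eq (K := ℝ) (V := Plane) x
  rw [h, Submodule.mem_span_singleton]
  obtain ⟨a, ha⟩ := x.exists_smul_dir
  obtain ⟨b, hb, -⟩ := x.exists_dir_eq
  constructor
  · rintro ⟨c, rfl⟩
    exact ⟨c * b, by rw [mul_smul, ← hb]⟩
  · rintro ⟨c, rfl⟩
    exact ⟨c * a, by rw [mul_smul, ← ha]⟩

lemma wedge_smul_smul (a b : ℝ) (v w : Plane) : wedge (a • v) (b • w) = a * b * wedge v w := by
  simp only [wedge, PiLp.smul_apply, smul_eq_mul]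
  ring

lemma RP1.sin_angle (x y : RP1) : Real.sin (RP1.angle x y) = |wedge x.unit y.unit| := by
  have h1 : Real.sin (RP1.angle x y) = Real.sin (InnerProductGeometry.angle x.dir y.dir) := by
    unfold RP1.angle
    rcases min_choice (InnerProductGeometry.angle x.dir y.dir)
      (Real.pi - InnerProductGeometry.angle x.dir y.dir) with h | h
    · rw [h]
    · rw [h, Real.sin_pi_sub]
  have h2 := InnerProductGeometry.sin_angle_mul_norm_mul_norm x.dir y.dir
  have h3 : inner ℝ x.dir x.dir * inner ℝ y.dir y.dir - inner ℝ x.dir y.dir * inner ℝ x.dir y.dir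
      = wedge x.dir y.dir ^ 2 := by
    simp only [inner_plane, wedge]
    ring
  rw [h3, Real.sqrt_sq_eq_abs] at h2
  obtain ⟨a, ha, ha'⟩ := x.exists_dir_eq
  obtain ⟨b, hb, hb'⟩ := y.exists_dir_eq
  have h4 : |wedge x.dir y.dir| = |wedge x.unit y.unit| * (‖x.dir‖ * ‖y.dir‖) := by
    rw [← ha', ← hb', ha, hb, wedge_smul_smul, abs_mul, abs_mul, mul_comm]
  rw [h4] at h2
  rw [h1]
  exact mul_right_cancel₀ (mul_ne_zero (norm_ne_zero_iff.2 x.dir_ne_zero)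
    (norm_ne_zero_iff.2 y.dir_ne_zero)) h2

/-- The sine of the angle of a pair of lines. -/
def sinAngle (p : LinePairs) : ℝ := |wedge p.1.1.unit p.1.2.unit|

lemma sin_pairAngle (p : LinePairs) : Real.sin (pairAngle p) = sinAngle p := RP1.sin_angle _ _

lemma measurable_unit_fst : Measurable fun p : LinePairs => p.1.1.unit :=
  measurable_unitOfDouble.comp (RP1.continuous_double.comp
    (continuous_fst.comp continuous_subtype_val)).measurable

lemma measurable_unit_snd : Measurable fun p : LinePairs => p.1.2.unit :=
  measurable_unitOfDouble.comp (RP1.continuous_double.comp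
    (continuous_snd.comp continuous_subtype_val)).measurable

lemma measurable_coord (i : Fin 2) : Measurable fun v : Plane => v i := by fun_prop

lemma measurable_wedge {β : Type*} [MeasurableSpace β] {f g : β → Plane} (hf : Measurable f)
    (hg : Measurable g) : Measurable fun b => wedge (f b) (g b) :=
  (((measurable_coord 0).comp hf).mul ((measurable_coord 1).comp hg)).sub
    (((measurable_coord 1).comp hf).mul ((measurable_coord 0).comp hg))

lemma measurable_sinAngle : Measurable sinAngle :=
  continuous_abs.measurable.comp (measurable_wedge measurable_unit_fst measurable_unit_snd)

lemma sinAngle_pos (p : LinePairs) : 0 < sinAngle p := by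
  refine abs_pos.2 fun h => p.2 (RP1.eq_of_wedge_dir ?_)
  obtain ⟨a, ha, -⟩ := p.1.1.exists_dir_eq
  obtain ⟨b, hb, -⟩ := p.1.2.exists_dir_eq
  rw [ha, hb, wedge_smul_smul, h, mul_zero]

lemma sinAngle_le_one (p : LinePairs) : sinAngle p ≤ 1 := by
  rw [← sin_pairAngle]
  exact Real.sin_le_one _

/-! ### Monotone transport of measures -/

section Transport

open ProbabilityTheory

variable {Ω : Type*} [MeasurableSpace Ω] {μ : Measure Ω} [IsProbabilityMeasure μ]

/-- The quantile function of a probability measure on the line. -/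
def quantile (ν : Measure ℝ) (x : ℝ) : ℝ :=
  -- Outside (0, 1) the set may be empty or unbounded below. The transport meets such arguments only
  -- on a null set.
  if x ∈ Set.Ioo (0 : ℝ) 1 then sInf {y | x ≤ cdf ν y} else 0

/-- The infimum is attained because the distribution function is right-continuous, so quantile and
distribution function form a Galois connection on (0, 1). -/
lemma quantile_le_iff (ν : Measure ℝ) {x : ℝ} (hx : x ∈ Set.Ioo (0 : ℝ) 1) (y : ℝ) :
    quantile ν x ≤ y ↔ x ≤ cdf ν y := by
  rw [quantile, if_pos hx]
  have hne : {y | x ≤ cdf ν y}.Nonempty := by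
    obtain ⟨y, hy⟩ := ((tendsto_cdf_atTop ν).eventually (lt_mem_nhds hx.2)).exists
    exact ⟨y, hy.le⟩
  have hbdd : BddBelow {y | x ≤ cdf ν y} := by
    obtain ⟨z, hz⟩ := ((tendsto_cdf_atBot ν).eventually (gt_mem_nhds hx.1)).exists
    refine ⟨z, fun y hy => ?_⟩
    by_contra! h
    exact absurd (hy.trans (monotone_cdf ν h.le)) (not_le.2 hz)
  constructor
  · intro h
    by_contra! hlt
    have hr : Tendsto (cdf ν) (𝓝[>] y) (𝓝 (cdf ν y)) :=
      ((cdf ν).right_continuous y).mono_left (nhdsWithin_mono _ Set.Ioi_subset_Ici_self)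
    obtain ⟨z, hz, hyz⟩ := ((hr.eventually (gt_mem_nhds hlt)).and self_mem_nhdsWithin).exists
    have : z ≤ sInf {y | x ≤ cdf ν y} := le_csInf hne fun w hw => by
      by_contra! h'
      exact absurd (le_trans hw (monotone_cdf ν h'.le)) (not_le.2 hz)
    exact absurd (this.trans h) (not_le.2 hyz)
  · exact fun h => csInf_le hbdd h

lemma measurable_quantile (ν : Measure ℝ) : Measurable (quantile ν) := by
  refine measurable_of_Iic fun y => ?_
  have : quantile ν ⁻¹' Set.Iic y = (Set.Ioo (0 : ℝ) 1 ∩ Set.Iic (cdf ν y)) ∪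
      ((Set.Ioo (0 : ℝ) 1)ᶜ ∩ {_x | 0 ≤ y}) := by
    ext x
    by_cases hx : x ∈ Set.Ioo (0 : ℝ) 1
    · have := quantile_le_iff ν hx y
      simp only [Set.mem_preimage, Set.mem_Iic, Set.mem_union, Set.mem_inter_iff, hx,
        Set.mem_compl_iff, true_and, not_true, false_and, or_false, this]
    · simp only [Set.mem_preimage, Set.mem_Iic, Set.mem_union, Set.mem_inter_iff, hx,
        Set.mem_compl_iff, false_and, false_or, not_false_iff, true_and, quantile, if_false,
        Set.mem_ofPred_eq]
  rw [this]
  exact (measurableSet_Ioo.inter measurableSet_Iic).union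
    (measurableSet_Ioo.compl.inter (MeasurableSet.const _))

variable {W : Ω → ℝ}

lemma cdf_map_eq (hW : Measurable W) (y : ℝ) : cdf (μ.map W) y = μ.real {ω | W ω ≤ y} := by
  have := Measure.isProbabilityMeasure_map (μ := μ) hW.aemeasurable
  rw [cdf_eq_real, measureReal_def, Measure.map_apply hW measurableSet_Iic]
  rfl

lemma continuous_cdf_map (hW : Measurable W) (h0 : ∀ w, μ {ω | W ω = w} = 0) :
    Continuous (cdf (μ.map W)) := by
  have := Measure.isProbabilityMeasure_map (μ := μ) hW.aemeasurable
  rw [continuous_iff_continuousAt]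
  intro y
  rw [(monotone_cdf _).continuousAt_iff_leftLim_eq_rightLim, (cdf _).rightLim_eq]
  have h1 : (cdf (μ.map W)).measure {y} = 0 := by
    rw [measure_cdf, Measure.map_apply hW (measurableSet_singleton y)]
    exact h0 y
  rw [StieltjesFunction.measure_singleton, ENNReal.ofReal_eq_zero] at h1
  exact le_antisymm ((monotone_cdf _).leftLim_le le_rfl) (by linarith)

/-- The probability integral transform. -/
lemma measureReal_cdf_le (hW : Measurable W) (h0 : ∀ w, μ {ω | W ω = w} = 0) {t : ℝ}
    (ht0 : 0 ≤ t) (ht1 : t ≤ 1) : μ.real {ω | cdf (μ.map W) (W ω) ≤ t} = t := by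
  have hc := continuous_cdf_map hW h0
  -- By continuity each s in (0, 1) is the value of the distribution function at some y, and {W ≤ y}
  -- has measure s. Taking s above and below t squeezes the event.
  have hlevel : ∀ s ∈ Set.Ioo (0 : ℝ) 1, ∃ y, cdf (μ.map W) y = s := fun s hs => by
    obtain ⟨a, ha⟩ := ((tendsto_cdf_atBot (μ.map W)).eventually (gt_mem_nhds hs.1)).exists
    obtain ⟨b, hb⟩ := ((tendsto_cdf_atTop (μ.map W)).eventually (lt_mem_nhds hs.2)).exists
    exact mem_range_of_exists_le_of_exists_ge hc ⟨a, ha.le⟩ ⟨b, hb.le⟩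
  apply le_antisymm
  · refine le_of_forall_gt_imp_ge_of_dense fun s hs => ?_
    rcases lt_or_ge s 1 with h1 | h1
    · obtain ⟨y, hy⟩ := hlevel s ⟨ht0.trans_lt hs, h1⟩
      rw [← hy, cdf_map_eq hW]
      refine measureReal_mono fun ω hω => ?_
      by_contra! h
      have h2 := monotone_cdf (μ.map W) (not_le.1 h).le
      exact absurd (h2.trans hω) (by rw [hy]; exact not_le.2 hs)
    · exact measureReal_le_one.trans h1
  · refine le_of_forall_lt_imp_le_of_dense fun s hs => ?_
    rcases lt_or_ge 0 s with h1 | h1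
    · obtain ⟨y, hy⟩ := hlevel s ⟨h1, hs.trans_le ht1⟩
      rw [← hy, cdf_map_eq hW]
      exact measureReal_mono fun ω hω =>
        (monotone_cdf (μ.map W) hω).trans (by rw [hy]; exact hs.le)
    · exact h1.trans measureReal_nonneg

/-- A measure on a standard Borel space is the image of a measure with an atomless marginal, by a
map that is monotone for given orders of the two spaces. -/
theorem exists_map_eq_monotone (hW : Measurable W) (h0 : ∀ w, μ {ω | W ω = w} = 0)
    {α : Type*} [MeasurableSpace α] (η : Measure α) [IsProbabilityMeasure η] {J : α → ℝ}
    (hJ : MeasurableEmbedding J) :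
    ∃ E : Ω → α, Measurable E ∧ μ.map E = η ∧
      (∀ a b, μ {ω | W ω ≤ a} ≤ η {p | J p ≤ b} → ∀ᵐ ω ∂μ, W ω ≤ a → J (E ω) ≤ b) ∧
      (∀ a b, η {p | J p ≤ b} ≤ μ {ω | W ω ≤ a} → ∀ᵐ ω ∂μ, J (E ω) ≤ b → W ω ≤ a) := by
  have : Nonempty α := by
    by_contra h
    rw [not_nonempty_iff] at h
    have h1 := measure_univ (μ := η)
    rw [Set.eq_empty_of_isEmpty (Set.univ : Set α), measure_empty] at h1
    exact zero_ne_one h1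
  have hpη := Measure.isProbabilityMeasure_map (μ := η) hJ.measurable.aemeasurable
  set FW := cdf (μ.map W) with hFW
  set FJ := cdf (η.map J) with hFJ
  have hFWm : Measurable fun ω => FW (W ω) := (monotone_cdf _).measurable.comp hW
  -- The distribution function makes W uniform on [0, 1], and the quantile function turns this into
  -- a variable with the law of J that is nondecreasing in W. Almost surely V lies in the range of
  -- J, and E is its preimage.
  let V : Ω → ℝ := fun ω => quantile (η.map J) (FW (W ω))
  have hV : Measurable V := (measurable_quantile _).comp hFWm
  have hpV := Measure.isProbabilityMeasure_map (μ := μ) hV.aemeasurable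
  have hio : ∀ᵐ ω ∂μ, FW (W ω) ∈ Set.Ioo (0 : ℝ) 1 := by
    have h1 : ∀ᵐ ω ∂μ, ¬ FW (W ω) ≤ 0 := by
      have := measureReal_cdf_le hW h0 le_rfl zero_le_one
      rw [measureReal_eq_zero_iff] at this
      rw [ae_iff]
      simpa using this
    have h2 : ∀ᵐ ω ∂μ, FW (W ω) ≠ 1 := by
      rw [ae_iff]
      have : ∀ t : ℝ, t < 1 → 0 ≤ t → μ.real {ω | ¬ FW (W ω) ≠ 1} ≤ 1 - t := by
        intro t ht ht0
        have h3 := measureReal_cdf_le hW h0 ht0 ht.le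
        have h4 : μ.real {ω | FW (W ω) ≤ t}ᶜ = 1 - t := by
          rw [probReal_compl_eq_one_sub (measurableSet_le hFWm measurable_const), h3]
        rw [← h4]
        refine measureReal_mono fun ω hω => ?_
        have : FW (W ω) = 1 := not_not.1 hω
        simp only [Set.mem_compl_iff, Set.mem_ofPred_eq, not_le, this, ht]
      have h5 : μ.real {ω | ¬ FW (W ω) ≠ 1} ≤ 0 := by
        refine le_of_forall_pos_le_add fun ε hε => ?_
        have := this (1 - min ε 1) (by simp [hε]) (by simp)
        linarith [min_le_left ε 1]
      exact (measureReal_eq_zero_iff).1 (le_antisymm h5 measureReal_nonneg)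
    filter_upwards [h1, h2] with ω h1 h2
    exact ⟨not_le.1 h1, lt_of_le_of_ne (cdf_le_one _ _) h2⟩
  have hVle : ∀ᵐ ω ∂μ, ∀ y, V ω ≤ y ↔ FW (W ω) ≤ FJ y := by
    filter_upwards [hio] with ω hω y using quantile_le_iff _ hω y
  have hlaw : μ.map V = η.map J := by
    refine Measure.eq_of_cdf _ _ ?_
    ext y
    rw [cdf_map_eq hV, ← hFJ]
    refine Eq.trans ?_ (measureReal_cdf_le hW h0 (cdf_nonneg _ y) (cdf_le_one _ y))
    refine measureReal_congr ?_
    filter_upwards [hVle] with ω hω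
    exact propext (hω y)
  have hrange : ∀ᵐ ω ∂μ, V ω ∈ Set.range J := by
    refine ae_of_ae_map hV.aemeasurable ?_
    rw [hlaw]
    refine (ae_map_iff (p := fun y => y ∈ Set.range J) hJ.measurable.aemeasurable
      hJ.measurableSet_range).2 ?_
    exact Eventually.of_forall fun p => ⟨p, rfl⟩
  let E : Ω → α := fun ω => hJ.invFun (V ω)
  have hJE : ∀ᵐ ω ∂μ, J (E ω) = V ω := by
    filter_upwards [hrange] with ω ⟨p, hp⟩
    change J (hJ.invFun (V ω)) = V ω
    rw [← hp, hJ.leftInverse_invFun p]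
  refine ⟨E, hJ.measurable_invFun.comp hV, ?_, fun a b hab => ?_, fun a b hab => ?_⟩
  · change μ.map (hJ.invFun ∘ V) = η
    rw [← Measure.map_map hJ.measurable_invFun hV, hlaw,
      Measure.map_map hJ.measurable_invFun hJ.measurable, hJ.leftInverse_invFun.comp_eq_id,
      Measure.map_id]
  · have hab' : FW a ≤ FJ b := by
      rw [cdf_map_eq hW, cdf_map_eq hJ.measurable]
      exact ENNReal.toReal_mono (measure_ne_top _ _) hab
    filter_upwards [hJE, hVle] with ω h1 h2 h3
    rw [h1, h2]
    exact (monotone_cdf _ h3).trans hab'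
  · have hab' : FJ b ≤ FW a := by
      rw [cdf_map_eq hW, cdf_map_eq hJ.measurable]
      exact ENNReal.toReal_mono (measure_ne_top _ _) hab
    -- The two events are nested and have equal measure, so W almost surely avoids the part above a
    -- of the plateau of its distribution function at height FW a.
    have h4 : ∀ᵐ ω ∂μ, FW (W ω) ≤ FW a → W ω ≤ a := by
      have h5 := measureReal_cdf_le hW h0 (cdf_nonneg (μ.map W) a) (cdf_le_one _ a)
      have h6 : FW a = μ.real {ω | W ω ≤ a} := cdf_map_eq hW a
      have h7 : {ω | W ω ≤ a} ⊆ {ω | FW (W ω) ≤ FW a} := fun ω hω => monotone_cdf _ hω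
      have h8 := measureReal_sdiff (μ := μ) h7 (measurableSet_le hW measurable_const)
      rw [h5, ← h6, sub_self, measureReal_eq_zero_iff] at h8
      rw [ae_iff]
      convert h8 using 2
      ext ω
      simp
    filter_upwards [hJE, hVle, h4] with ω h1 h2 h4 h3
    rw [h1, h2] at h3
    exact h4 (h3.trans hab')

end Transport

/-! ### Sets with small boundary along the orbits -/

section Levels

variable {Ω : Type*} [MeasurableSpace Ω] {μ : Measure Ω} [IsProbabilityMeasure μ] {T : Ω ≃ᵐ Ω}

/-- The points that ever visit B form a set that contains its own preimage under T; it is not null,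
as it contains B. -/
lemma ae_exists_iterate_mem (hT : Ergodic T μ) {B : Set Ω} (hB : MeasurableSet B)
    (hB0 : μ B ≠ 0) : ∀ᵐ ω ∂μ, ∃ n : ℕ, T^[n] ω ∈ B := by
  let R : Set Ω := {ω | ∃ n : ℕ, T^[n] ω ∈ B}
  have hR : MeasurableSet R := by
    have : R = ⋃ n : ℕ, T^[n] ⁻¹' B := by ext; simp [R]
    rw [this]
    exact MeasurableSet.iUnion fun n => (T.measurable.iterate n) hB
  have hle : T ⁻¹' R ≤ᵐ[μ] R :=
    Eventually.of_forall fun ω ⟨n, hn⟩ => ⟨n + 1, hn⟩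
  rcases hT.ae_empty_or_univ_of_preimage_ae_le hR.nullMeasurableSet hle with h | h
  · have hBR : B ⊆ R := fun ω hω => ⟨0, hω⟩
    exact absurd (measure_mono_null hBR (ae_eq_empty.1 h)) hB0
  · exact ae_iff.2 (ae_eq_univ.1 h)

variable {φ : Ω → ℝ}

/-- An atomless function that changes along the orbits only at the visits to a small set. -/
lemma exists_function_constant_off_small (hT : Ergodic T μ) (hφ : Measurable φ)
    (h0 : ∀ w, μ {ω | φ ω = w} = 0) (h01 : ∀ ω, φ ω ∈ Set.Icc (0 : ℝ) 1) {δ : ℝ} (hδ : 0 < δ) :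
    ∃ (B : Set Ω) (u : Ω → ℝ), MeasurableSet B ∧ μ B ≤ ENNReal.ofReal δ ∧ Measurable u ∧
      (∀ w, μ {ω | u ω = w} = 0) ∧ (∀ ω, u ω ∈ Set.Icc (0 : ℝ) 1) ∧
      ∀ ω, u (T ω) = u ω ∨ T ω ∈ B := by
  classical
  obtain ⟨y, hy⟩ : ∃ y, ProbabilityTheory.cdf (μ.map φ) y = min δ 1 / 2 := by
    have h1 : 0 < min δ 1 / 2 := by positivity
    have h2 : min δ 1 / 2 < 1 := by linarith [min_le_right δ 1]
    obtain ⟨a, ha⟩ :=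
      ((ProbabilityTheory.tendsto_cdf_atBot (μ.map φ)).eventually (gt_mem_nhds h1)).exists
    obtain ⟨b, hb⟩ :=
      ((ProbabilityTheory.tendsto_cdf_atTop (μ.map φ)).eventually (lt_mem_nhds h2)).exists
    exact mem_range_of_exists_le_of_exists_ge (continuous_cdf_map hφ h0) ⟨a, ha.le⟩ ⟨b, hb.le⟩
  rw [cdf_map_eq hφ] at hy
  set B₀ : Set Ω := {ω | φ ω ≤ y} with hB₀
  have hB₀m : MeasurableSet B₀ := measurableSet_le hφ measurable_const
  have hB₀0 : μ B₀ ≠ 0 := fun h => by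
    rw [measureReal_def, h] at hy
    have : 0 < min δ 1 / 2 := by positivity
    simp only [ENNReal.toReal_zero] at hy
    linarith
  have hret := ae_exists_iterate_mem hT.symm hB₀m hB₀0
  let R : Set Ω := {ω | ∃ n : ℕ, T.symm^[n] ω ∈ B₀}
  have hR : MeasurableSet R := by
    have : R = ⋃ n : ℕ, T.symm^[n] ⁻¹' B₀ := by ext; simp [R]
    rw [this]
    exact MeasurableSet.iUnion fun n => (T.symm.measurable.iterate n) hB₀m
  -- Adding the null set of points whose backward orbit misses B₀ makes the time since the last
  -- visit finite everywhere.
  let B : Set Ω := B₀ ∪ Rᶜ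
  have hB : MeasurableSet B := hB₀m.union hR.compl
  have hex : ∀ ω, ∃ n : ℕ, T.symm^[n] ω ∈ B := fun ω => by
    by_cases h : ω ∈ R
    · obtain ⟨n, hn⟩ := h
      exact ⟨n, Or.inl hn⟩
    · exact ⟨0, Or.inr h⟩
  let N : Ω → ℕ := fun ω => Nat.find (hex ω)
  have hN : Measurable N := measurable_find hex fun n => (T.symm.measurable.iterate n) hB
  -- u remembers the value of φ at the last visit to B. It changes only at a new visit, and it stays
  -- atomless because its level sets are covered by countably many images of level sets of φ.
  let u : Ω → ℝ := fun ω => φ (T.symm^[N ω] ω)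
  refine ⟨B, u, hB, ?_, ?_, fun w => ?_, fun ω => h01 _, fun ω => ?_⟩
  · have h1 : μ Rᶜ = 0 := ae_iff.1 hret
    refine (measure_union_le _ _).trans ?_
    rw [h1, add_zero, ← ofReal_measureReal (measure_ne_top μ _), hy]
    refine ENNReal.ofReal_le_ofReal ?_
    linarith [min_le_left δ 1]
  · have h1 : Measurable fun p : ℕ × Ω => φ (T.symm^[p.1] p.2) :=
      measurable_from_prod_countable_right fun n => hφ.comp (T.symm.measurable.iterate n)
    exact h1.comp (hN.prodMk measurable_id)
  · refine measure_mono_null (t := ⋃ n : ℕ, T.symm^[n] ⁻¹' {ω | φ ω = w})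
      (fun ω hω => Set.mem_iUnion.2 ⟨N ω, hω⟩) (measure_iUnion_null fun n => ?_)
    rw [(hT.symm.toMeasurePreserving.iterate n).measure_preimage
      (measurableSet_eq_fun hφ measurable_const).nullMeasurableSet]
    exact h0 w
  · by_cases hω : T ω ∈ B
    · exact Or.inr hω
    · left
      have hNT : N (T ω) = N ω + 1 := by
        have h1 : ∀ n, T.symm^[n + 1] (T ω) = T.symm^[n] ω := fun n => by
          rw [Function.iterate_succ_apply, T.symm_apply_apply]
        refine (Nat.find_eq_iff _).2 ⟨?_, fun m hm => ?_⟩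
        · rw [h1]
          exact Nat.find_spec (hex ω)
        · cases m with
          | zero => exact hω
          | succ m =>
            rw [h1]
            exact Nat.find_min (hex ω) (Nat.lt_of_succ_lt_succ hm)
      change φ (T.symm^[N (T ω)] (T ω)) = φ (T.symm^[N ω] ω)
      rw [hNT, Function.iterate_succ_apply, T.symm_apply_apply]

/-! ### Prescribing the measures of unions of sublevel sets -/

/-- The union of the sublevel sets `{u j ≤ t j}` for `k ≤ j < m`. -/
def sublevelUnion (u : ℕ → Ω → ℝ) (k m : ℕ) (t : ℕ → ℝ) : Set Ω :=
  {ω | ∃ j, k ≤ j ∧ j < m ∧ u j ω ≤ t j}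

variable {u : ℕ → Ω → ℝ}

lemma measurableSet_sublevelUnion (hu : ∀ j, Measurable (u j)) (k m : ℕ) (t : ℕ → ℝ) :
    MeasurableSet (sublevelUnion u k m t) := by
  have : sublevelUnion u k m t = ⋃ j, ⋃ (_ : k ≤ j), ⋃ (_ : j < m), {ω | u j ω ≤ t j} := by
    ext
    simp only [sublevelUnion, Set.mem_iUnion, exists_prop]
    rfl
  rw [this]
  exact MeasurableSet.iUnion fun j => MeasurableSet.iUnion fun _ => MeasurableSet.iUnion fun _ =>
    measurableSet_le (hu j) measurable_const

/-- Almost no ω satisfies u j ω = t j for some j, and for the others membership is locally constant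
in t, as only finitely many coordinates matter. -/
lemma continuous_measureReal_sublevelUnion (hu : ∀ j, Measurable (u j))
    (h0 : ∀ j w, μ {ω | u j ω = w} = 0) (k m : ℕ) :
    Continuous fun t => μ.real (sublevelUnion u k m t) := by
  rw [continuous_iff_continuousAt]
  intro t
  refine (ENNReal.tendsto_toReal (measure_ne_top μ _)).comp ?_
  refine tendsto_measure_of_ae_tendsto_indicator_of_isFiniteMeasure (𝓝 t)
    (measurableSet_sublevelUnion hu k m t) (fun t' => measurableSet_sublevelUnion hu k m t') ?_
  have hne : ∀ᵐ ω ∂μ, ∀ j, u j ω ≠ t j := ae_all_iff.2 fun j => by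
    rw [ae_iff]
    simpa using h0 j (t j)
  filter_upwards [hne] with ω hω
  have hj : ∀ j ∈ Finset.range m, ∀ᶠ t' in 𝓝 t, (u j ω ≤ t' j ↔ u j ω ≤ t j) := by
    intro j _
    have hcont : Tendsto (fun t' : ℕ → ℝ => t' j) (𝓝 t) (𝓝 (t j)) :=
      (continuous_apply j).continuousAt
    rcases lt_or_gt_of_ne (hω j) with h | h
    · filter_upwards [hcont.eventually (lt_mem_nhds h)] with t' ht'
      exact iff_of_true ht'.le h.le
    · filter_upwards [hcont.eventually (gt_mem_nhds h)] with t' ht'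
      exact iff_of_false (not_le.2 ht') (not_le.2 h)
  filter_upwards [(Finset.eventually_all _).2 hj] with t' ht'
  constructor
  · rintro ⟨j, h1, h2, h3⟩
    exact ⟨j, h1, h2, (ht' j (Finset.mem_range.2 h2)).1 h3⟩
  · rintro ⟨j, h1, h2, h3⟩
    exact ⟨j, h1, h2, (ht' j (Finset.mem_range.2 h2)).2 h3⟩

/-- The thresholds are found from the last to the first. With the later ones fixed, the current one
is given by the intermediate value theorem: at 0 it adds nothing to a union of measure p (k₀ + 1)
(or to the empty set), and at 1 it gives the whole space. -/
lemma exists_finite_levels (hu : ∀ j, Measurable (u j)) (h0 : ∀ j w, μ {ω | u j ω = w} = 0)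
    (h01 : ∀ j ω, u j ω ∈ Set.Icc (0 : ℝ) 1) {p : ℕ → ℝ} (hp : Antitone p)
    (hp0 : ∀ k, 0 ≤ p k) (hp1 : ∀ k, p k ≤ 1) (d k₀ : ℕ) :
    ∃ t : ℕ → ℝ, (∀ j, t j ∈ Set.Icc (0 : ℝ) 1) ∧
      ∀ k, k₀ ≤ k → k < k₀ + d → μ.real (sublevelUnion u k (k₀ + d) t) = p k := by
  induction d generalizing k₀ with
  | zero => exact ⟨fun _ => 0, fun _ => by simp, fun k h1 h2 => by omega⟩
  | succ d ih =>
    obtain ⟨t, ht, htp⟩ := ih (k₀ + 1)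
    rw [show k₀ + 1 + d = k₀ + (d + 1) by ring] at htp
    have hcont : Continuous fun s : ℝ =>
        μ.real (sublevelUnion u k₀ (k₀ + (d + 1)) (Function.update t k₀ s)) :=
      (continuous_measureReal_sublevelUnion hu h0 _ _).comp
        (continuous_const.update k₀ continuous_id)
    have hlow : μ.real (sublevelUnion u k₀ (k₀ + (d + 1)) (Function.update t k₀ 0)) ≤ p k₀ := by
      have h1 : μ.real (sublevelUnion u k₀ (k₀ + (d + 1)) (Function.update t k₀ 0)) ≤
          μ.real (sublevelUnion u (k₀ + 1) (k₀ + (d + 1)) t) := by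
        refine ENNReal.toReal_mono (measure_ne_top _ _) (measure_mono_ae ?_)
        have hne : ∀ᵐ ω ∂μ, u k₀ ω ≠ 0 := by
          rw [ae_iff]
          simpa using h0 k₀ 0
        filter_upwards [hne] with ω hω ⟨j, hj1, hj2, hj3⟩
        rcases hj1.eq_or_lt with rfl | hlt
        · rw [Function.update_self] at hj3
          exact absurd (le_antisymm hj3 (h01 _ ω).1) hω
        · rw [Function.update_of_ne (by omega)] at hj3
          exact ⟨j, hlt, hj2, hj3⟩
      refine h1.trans ?_
      rcases Nat.eq_zero_or_pos d with rfl | hd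
      · have : sublevelUnion u (k₀ + 1) (k₀ + (0 + 1)) t = ∅ :=
          Set.eq_empty_of_forall_notMem fun ω ⟨j, hj1, hj2, _⟩ => by omega
        rw [this, measureReal_empty]
        exact hp0 _
      · rw [htp (k₀ + 1) le_rfl (by omega)]
        exact hp (by omega)
    have hhigh : p k₀ ≤ μ.real (sublevelUnion u k₀ (k₀ + (d + 1)) (Function.update t k₀ 1)) := by
      have : sublevelUnion u k₀ (k₀ + (d + 1)) (Function.update t k₀ 1) = Set.univ :=
        Set.eq_univ_of_forall fun ω => ⟨k₀, le_rfl, by omega, by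
          rw [Function.update_self]; exact (h01 _ ω).2⟩
      rw [this, probReal_univ]
      exact hp1 _
    obtain ⟨s, hs, hsp⟩ := intermediate_value_Icc zero_le_one hcont.continuousOn ⟨hlow, hhigh⟩
    refine ⟨Function.update t k₀ s, fun j => ?_, fun k hk1 hk2 => ?_⟩
    · by_cases hj : j = k₀
      · subst hj
        simpa using hs
      · rw [Function.update_of_ne hj]
        exact ht j
    · rcases hk1.eq_or_lt with rfl | hlt
      · exact hsp
      · rw [← htp k hlt hk2]
        congr 1
        ext ω
        refine exists_congr fun j => and_congr_right fun hj => ?_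
        rw [Function.update_of_ne (by omega)]

/-- A limit of finite solutions in the compact cube [0, 1]^ℕ. Truncating a union at index m loses
measure at most p m, uniformly in the finite solutions, so no measure escapes in the limit. -/
lemma exists_levels (hu : ∀ j, Measurable (u j)) (h0 : ∀ j w, μ {ω | u j ω = w} = 0)
    (h01 : ∀ j ω, u j ω ∈ Set.Icc (0 : ℝ) 1) {p : ℕ → ℝ} (hp : Antitone p)
    (hp0 : ∀ k, 0 ≤ p k) (hp1 : ∀ k, p k ≤ 1) (hlim : Tendsto p atTop (𝓝 0)) :
    ∃ t : ℕ → ℝ, ∀ k, μ.real {ω | ∃ j, k ≤ j ∧ u j ω ≤ t j} = p k := by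
  have hfin := fun n => exists_finite_levels hu h0 h01 hp hp0 hp1 n 0
  choose τ hτ hτp using hfin
  have hK : IsCompact (Set.univ.pi fun _ : ℕ => Set.Icc (0 : ℝ) 1) :=
    isCompact_univ_pi fun _ => isCompact_Icc
  obtain ⟨t, -, ψ, hψ, hψt⟩ := hK.tendsto_subseq fun n => Set.mem_univ_pi.2 (hτ n)
  refine ⟨t, fun k => ?_⟩
  have hbd : ∀ m, k ≤ m → p k - p m ≤ μ.real (sublevelUnion u k m t) ∧
      μ.real (sublevelUnion u k m t) ≤ p k := by
    intro m hkm
    have hc : Tendsto (fun n => μ.real (sublevelUnion u k m (τ (ψ n)))) atTop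
        (𝓝 (μ.real (sublevelUnion u k m t))) :=
      ((continuous_measureReal_sublevelUnion hu h0 k m).tendsto t).comp hψt
    have hev : ∀ᶠ n in atTop, p k - p m ≤ μ.real (sublevelUnion u k m (τ (ψ n))) ∧
        μ.real (sublevelUnion u k m (τ (ψ n))) ≤ p k := by
      filter_upwards [eventually_gt_atTop m] with n hn
      have hmn : m < ψ n := hn.trans_le (hψ.id_le n)
      have e1 := hτp (ψ n) k (Nat.zero_le _) (by omega)
      have e2 := hτp (ψ n) m (Nat.zero_le _) (by omega)
      rw [zero_add] at e1 e2
      have h1 : sublevelUnion u k (ψ n) (τ (ψ n)) ⊆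
          sublevelUnion u k m (τ (ψ n)) ∪ sublevelUnion u m (ψ n) (τ (ψ n)) := by
        rintro ω ⟨j, a, b, c⟩
        rcases lt_or_ge j m with h | h
        · exact Or.inl ⟨j, a, h, c⟩
        · exact Or.inr ⟨j, h, b, c⟩
      have h2 : sublevelUnion u k m (τ (ψ n)) ⊆ sublevelUnion u k (ψ n) (τ (ψ n)) := by
        rintro ω ⟨j, a, b, c⟩
        exact ⟨j, a, by omega, c⟩
      have h3 := (measureReal_mono (μ := μ) h1).trans (measureReal_union_le _ _)
      have h4 := measureReal_mono (μ := μ) h2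
      constructor <;> linarith
    exact ⟨ge_of_tendsto hc (hev.mono fun _ h => h.1), le_of_tendsto hc (hev.mono fun _ h => h.2)⟩
  have hunion : {ω | ∃ j, k ≤ j ∧ u j ω ≤ t j} = ⋃ m, sublevelUnion u k m t := by
    ext ω
    simp only [Set.mem_iUnion]
    exact ⟨fun ⟨j, a, b⟩ => ⟨j + 1, j, a, by omega, b⟩, fun ⟨m, j, a, _, c⟩ => ⟨j, a, c⟩⟩
  have hmono : Monotone fun m => sublevelUnion u k m t :=
    fun m m' hm ω ⟨j, a, b, c⟩ => ⟨j, a, by omega, c⟩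
  have hto : Tendsto (fun m => μ.real (sublevelUnion u k m t)) atTop
      (𝓝 (μ.real {ω | ∃ j, k ≤ j ∧ u j ω ≤ t j})) := by
    rw [hunion]
    exact (ENNReal.tendsto_toReal (measure_ne_top μ _)).comp (tendsto_measure_iUnion_atTop hmono)
  refine tendsto_nhds_unique hto ?_
  have hpl : Tendsto (fun m => p k - p m) atTop (𝓝 (p k)) := by
    simpa using tendsto_const_nhds.sub hlim
  refine tendsto_of_tendsto_of_tendsto_of_le_of_le' hpl tendsto_const_nhds ?_ ?_
  · filter_upwards [eventually_ge_atTop k] with m hm using (hbd m hm).1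
  · filter_upwards [eventually_ge_atTop k] with m hm using (hbd m hm).2

/-! ### Nested neighborhoods -/

/-- The points whose orbit meets `B` at a time in `[-i, i]`. -/
def orbitNhd (T : Ω ≃ᵐ Ω) (B : Set Ω) : ℕ → Set Ω
  | 0 => B
  | i + 1 => orbitNhd T B i ∪ (T ⁻¹' orbitNhd T B i ∪ T.symm ⁻¹' orbitNhd T B i)

lemma measurableSet_orbitNhd {B : Set Ω} (hB : MeasurableSet B) (i : ℕ) :
    MeasurableSet (orbitNhd T B i) := by
  induction i with
  | zero => exact hB
  | succ i ih => exact ih.union ((T.measurable ih).union (T.symm.measurable ih))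

omit [IsProbabilityMeasure μ] in
lemma measure_orbitNhd_le (hT : MeasurePreserving T μ μ) {B : Set Ω} (hB : MeasurableSet B)
    (i : ℕ) : μ (orbitNhd T B i) ≤ 3 ^ i * μ B := by
  induction i with
  | zero => simp [orbitNhd]
  | succ i ih =>
    have hm := (measurableSet_orbitNhd (T := T) hB i).nullMeasurableSet (μ := μ)
    have h1 := hT.measure_preimage hm
    have h2 := hT.symm.measure_preimage hm
    calc μ (orbitNhd T B (i + 1))
        ≤ μ (orbitNhd T B i) + (μ (T ⁻¹' orbitNhd T B i) + μ (T.symm ⁻¹' orbitNhd T B i)) :=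
          (measure_union_le _ _).trans (add_le_add le_rfl (measure_union_le _ _))
      _ = 3 * μ (orbitNhd T B i) := by rw [h1, h2]; ring
      _ ≤ 3 * (3 ^ i * μ B) := by gcongr
      _ = 3 ^ (i + 1) * μ B := by ring

lemma subset_orbitNhd (B : Set Ω) (i : ℕ) : B ⊆ orbitNhd T B i := by
  induction i with
  | zero => exact subset_rfl
  | succ i ih => exact ih.trans Set.subset_union_left

/-- Nested sets of nearly prescribed measures, each of which contains the neighborhood along the
orbits of the next one. -/
theorem exists_nested_sets (hT : Ergodic T μ) (hφ : Measurable φ)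
    (h0 : ∀ w, μ {ω | φ ω = w} = 0) (h01 : ∀ ω, φ ω ∈ Set.Icc (0 : ℝ) 1)
    {q : ℕ → ℝ} (hq : StrictAnti q) (hq1 : q 0 ≤ 1) (hlim : Tendsto q atTop (𝓝 0)) :
    ∃ G : ℕ → Set Ω, (∀ k, MeasurableSet (G k)) ∧ Antitone G ∧
      (∀ k, ∀ ω ∈ G (k + 1), T ω ∈ G k ∧ T.symm ω ∈ G k) ∧ (∀ ω, ∃ k, ω ∉ G k) ∧
      ∀ k, q (k + 1) ≤ μ.real (G k) ∧ μ.real (G k) ≤ q k := by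
  have hq0 : ∀ k, 0 ≤ q k := fun k => hq.antitone.le_of_tendsto hlim k
  -- A jump set of measure at most d j has an orbit neighborhood of radius i ≤ j of measure at most
  -- 3^j d j. The halving in j lets all neighborhoods used at level k fit in the slack q k - q
  -- (k+1).
  have hd : ∀ j : ℕ, ∃ d : ℝ, 0 < d ∧ ∀ i ≤ j, 3 ^ j * d ≤ (q i - q (i + 1)) / 2 / 2 ^ j := by
    intro j
    have : ∀ i ∈ Finset.range (j + 1), ∀ᶠ d : ℝ in 𝓝[>] 0,
        3 ^ j * d ≤ (q i - q (i + 1)) / 2 / 2 ^ j := by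
      intro i _
      have h1 : Tendsto (fun d : ℝ => 3 ^ j * d) (𝓝[>] 0) (𝓝 (3 ^ j * 0)) :=
        ((continuous_const.mul continuous_id).tendsto 0).mono_left nhdsWithin_le_nhds
      rw [mul_zero] at h1
      have h2 : 0 < (q i - q (i + 1)) / 2 / 2 ^ j := by
        have := hq (Nat.lt_succ_self i)
        have : 0 < q i - q (i + 1) := by linarith
        positivity
      filter_upwards [h1.eventually (gt_mem_nhds h2)] with d hd using hd.le
    obtain ⟨d, hd1, hd2⟩ := (((Finset.eventually_all _).2 this).and self_mem_nhdsWithin).exists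
    exact ⟨d, hd2, fun i hi => hd1 i (Finset.mem_range.2 (by omega))⟩
  choose d hd0 hd using hd
  choose B u hB hBd hu hu0 hu01 huT using
    fun j => exists_function_constant_off_small hT hφ h0 h01 (hd0 j)
  -- The unions get measure q (k+1) instead of q k, which leaves the slack for the neighborhoods.
  obtain ⟨t, ht⟩ := exists_levels (μ := μ) hu hu0 hu01 (p := fun k => q (k + 1))
    (fun a b h => hq.antitone (by omega)) (fun k => hq0 _)
    (fun k => (hq.antitone (Nat.zero_le _)).trans hq1) (hlim.comp (tendsto_add_atTop_nat 1))
  -- The jump set with index j enters level k with radius j - k. Passing from level k + 1 to level k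
  -- thus widens each neighborhood by one step, and absorbs both the jumps of u j and a step of T or
  -- of its inverse.
  let H : ℕ → Set Ω := fun k =>
    {ω | ∃ i, u (k + i) ω ≤ t (k + i) ∨ ω ∈ orbitNhd T (B (k + i)) i}
  have hH : ∀ k, MeasurableSet (H k) := fun k => by
    have : H k = ⋃ i, ({ω | u (k + i) ω ≤ t (k + i)} ∪ orbitNhd T (B (k + i)) i) := by
      ext; simp [H]
    rw [this]
    exact MeasurableSet.iUnion fun i => (measurableSet_le (hu _) measurable_const).union
      (measurableSet_orbitNhd (hB _) i)
  have hstep : ∀ k, ∀ ω ∈ H (k + 1), ω ∈ H k ∧ T ω ∈ H k ∧ T.symm ω ∈ H k := by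
    rintro k ω ⟨i, hi⟩
    rw [show k + 1 + i = k + (i + 1) by ring] at hi
    rcases hi with hi | hi
    · refine ⟨⟨i + 1, Or.inl hi⟩, ⟨i + 1, ?_⟩, ⟨i + 1, ?_⟩⟩
      · rcases huT (k + (i + 1)) ω with h | h
        · exact Or.inl (h.trans_le hi)
        · exact Or.inr (subset_orbitNhd _ _ h)
      · rcases huT (k + (i + 1)) (T.symm ω) with h | h
        · rw [T.apply_symm_apply] at h
          exact Or.inl (h.symm.trans_le hi)
        · exact Or.inr (Or.inr (Or.inl (subset_orbitNhd _ _ h)))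
    · refine ⟨⟨i + 1, Or.inr (Or.inl hi)⟩, ⟨i + 1, Or.inr (Or.inr (Or.inr ?_))⟩,
        ⟨i + 1, Or.inr (Or.inr (Or.inl ?_))⟩⟩
      · simpa using hi
      · simpa using hi
  have hanti : Antitone H := antitone_nat_of_succ_le fun k ω hω => (hstep k ω hω).1
  have hlow : ∀ k, q (k + 1) ≤ μ.real (H k) := fun k => by
    rw [← ht k]
    refine measureReal_mono ?_
    rintro ω ⟨j, hj, h⟩
    exact ⟨j - k, Or.inl (by rwa [Nat.add_sub_cancel' hj])⟩
  have hhigh : ∀ k, μ.real (H k) ≤ q k := by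
    intro k
    have hsub : H k ⊆ {ω | ∃ j, k ≤ j ∧ u j ω ≤ t j} ∪ ⋃ i, orbitNhd T (B (k + i)) i := by
      rintro ω ⟨i, hi | hi⟩
      · exact Or.inl ⟨k + i, by omega, hi⟩
      · exact Or.inr (Set.mem_iUnion.2 ⟨i, hi⟩)
    have hgap : 0 ≤ q k - q (k + 1) := by linarith [hq (Nat.lt_succ_self k)]
    have hs : μ (⋃ i, orbitNhd T (B (k + i)) i) ≤ ENNReal.ofReal (q k - q (k + 1)) := by
      refine (measure_iUnion_le _).trans ?_
      rw [← (hasSum_geometric_two' (q k - q (k + 1))).tsum_eq,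
        ENNReal.ofReal_tsum_of_nonneg (fun i => by positivity)
          (hasSum_geometric_two' (q k - q (k + 1))).summable]
      refine ENNReal.tsum_le_tsum fun i => ?_
      refine (measure_orbitNhd_le hT.toMeasurePreserving (hB _) i).trans ?_
      refine (mul_le_mul_right (hBd (k + i)) _).trans ?_
      rw [show (3 : ENNReal) ^ i = ENNReal.ofReal (3 ^ i) by
        rw [ENNReal.ofReal_pow (by norm_num)]; norm_num,
        ← ENNReal.ofReal_mul (by positivity)]
      refine ENNReal.ofReal_le_ofReal ?_
      have h1 : (3 : ℝ) ^ i * d (k + i) ≤ 3 ^ (k + i) * d (k + i) :=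
        mul_le_mul_of_nonneg_right (pow_le_pow_right₀ (by norm_num) (by omega)) (hd0 _).le
      refine (h1.trans (hd (k + i) k (by omega))).trans ?_
      exact div_le_div_of_nonneg_left (by positivity) (by positivity)
        (pow_le_pow_right₀ (by norm_num) (by omega))
    have h2 := measureReal_mono (μ := μ) hsub
    have h3 := h2.trans (measureReal_union_le _ _)
    have h4 : μ.real (⋃ i, orbitNhd T (B (k + i)) i) ≤ q k - q (k + 1) :=
      ENNReal.toReal_le_of_le_ofReal hgap hs
    rw [ht k] at h3
    linarith
  -- The intersection is null and invariant under T and its inverse, so it can be removed without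
  -- spoiling the inclusions; afterwards every point leaves the sequence.
  let I : Set Ω := ⋂ k, H k
  have hI : MeasurableSet I := MeasurableSet.iInter hH
  have hI0 : μ I = 0 := by
    have : μ.real I ≤ 0 := ge_of_tendsto' hlim fun k =>
      (measureReal_mono (Set.iInter_subset H k)).trans (hhigh k)
    exact (measureReal_eq_zero_iff).1 (le_antisymm this measureReal_nonneg)
  have hIT : ∀ ω, T ω ∈ I → ω ∈ I := fun ω hω => Set.mem_iInter.2 fun k => by
    simpa using (hstep k _ (Set.mem_iInter.1 hω (k + 1))).2.2
  have hIS : ∀ ω, T.symm ω ∈ I → ω ∈ I := fun ω hω => Set.mem_iInter.2 fun k => by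
    simpa using (hstep k _ (Set.mem_iInter.1 hω (k + 1))).2.1
  have hmeas : ∀ k, μ.real (H k \ I) = μ.real (H k) := fun k => by
    rw [measureReal_def, measure_sdiff_null hI0, measureReal_def]
  refine ⟨fun k => H k \ I, fun k => (hH k).diff hI,
    fun a b h ω hω => ⟨hanti h hω.1, hω.2⟩, fun k ω hω => ?_, fun ω => ?_, fun k => ?_⟩
  · have h := hstep k ω hω.1
    exact ⟨⟨h.2.1, fun h' => hω.2 (hIT ω h')⟩, ⟨h.2.2, fun h' => hω.2 (hIS ω h')⟩⟩
  · by_contra! h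
    exact (h 0).2 (Set.mem_iInter.2 fun k => (h k).1)
  · rw [hmeas k]
    exact ⟨hlow k, hhigh k⟩

end Levels

/-! ### Line pairs with a prescribed law and angles of bounded variation along the orbits -/

section LevelCode

variable {α : Type*} {G : ℕ → Set α}

open Classical in
/-- A real code of a point for which the sets of the decreasing sequence `G` are half-lines. -/
def levelCode (hex : ∀ x, ∃ k, x ∉ G k) (ι : α → ℝ) (x : α) : ℝ := -(Nat.find (hex x) : ℝ) - ι x

/-- x lies in G k exactly when its first exit index is at least k + 1; subtracting a term of [0, 1)
does not affect this comparison. The term ι separates points that have the same exit index. -/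
lemma levelCode_le_iff (hG : Antitone G) (hex : ∀ x, ∃ k, x ∉ G k) {ι : α → ℝ}
    (hι : ∀ x, ι x ∈ Set.Ico (0 : ℝ) 1) (x : α) (k : ℕ) :
    levelCode hex ι x ≤ -((k : ℝ) + 1) ↔ x ∈ G k := by
  classical
  have h1 : x ∈ G k ↔ k < Nat.find (hex x) := by
    rw [Nat.lt_find_iff]
    exact ⟨fun h m hm => not_not.2 (hG hm h), fun h => not_not.1 (h k le_rfl)⟩
  rw [h1, levelCode]
  obtain ⟨h2, h3⟩ := hι x
  constructor
  · intro h
    have : (k : ℝ) < Nat.find (hex x) := by linarith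
    exact_mod_cast this
  · intro h
    have : (k : ℝ) + 1 ≤ Nat.find (hex x) := by exact_mod_cast h
    linarith

lemma levelCode_injective (hex : ∀ x, ∃ k, x ∉ G k) {ι : α → ℝ}
    (hι : ∀ x, ι x ∈ Set.Ico (0 : ℝ) 1) (hinj : Function.Injective ι) :
    Function.Injective (levelCode hex ι) := by
  classical
  intro x y h
  unfold levelCode at h
  obtain ⟨h1, h2⟩ := hι x
  obtain ⟨h3, h4⟩ := hι y
  have h5 : (Nat.find (hex x) : ℝ) < Nat.find (hex y) + 1 := by linarith
  have h6 : (Nat.find (hex y) : ℝ) < Nat.find (hex x) + 1 := by linarith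
  have h7 : Nat.find (hex x) < Nat.find (hex y) + 1 := by exact_mod_cast h5
  have h8 : Nat.find (hex y) < Nat.find (hex x) + 1 := by exact_mod_cast h6
  rw [show Nat.find (hex x) = Nat.find (hex y) by omega] at h
  exact hinj (by linarith)

lemma measurable_levelCode [MeasurableSpace α] (hG : ∀ k, MeasurableSet (G k))
    (hex : ∀ x, ∃ k, x ∉ G k) {ι : α → ℝ} (hι : Measurable ι) :
    Measurable (levelCode hex ι) := by
  classical
  have h : Measurable fun x => Nat.find (hex x) := measurable_find hex fun k => (hG k).compl
  have h' : Measurable fun n : ℕ => -(n : ℝ) := measurable_from_top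
  exact (h'.comp h).sub hι

lemma measure_levelCode_eq [MeasurableSpace α] {μ : Measure α} (hex : ∀ x, ∃ k, x ∉ G k)
    {ι : α → ℝ} (h0 : ∀ w, μ {x | ι x = w} = 0) (w : ℝ) :
    μ {x | levelCode hex ι x = w} = 0 := by
  classical
  refine measure_mono_null (t := ⋃ n : ℕ, {x | ι x = -w - n}) (fun x hx => ?_)
    (measure_iUnion_null fun n => h0 _)
  refine Set.mem_iUnion.2 ⟨Nat.find (hex x), ?_⟩
  have hx' : -(Nat.find (hex x) : ℝ) - ι x = w := hx
  change ι x = -w - Nat.find (hex x)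
  linarith

end LevelCode

/-- The isomorphism with the interval is only measurable up to null sets, so it is replaced by a
measurable modification, which is still atomless. -/
lemma exists_measurable_atomless {Ω : Type*} [MeasurableSpace Ω] {μ : Measure Ω}
    (hμ : IsNonatomicLebesgueSpace μ) :
    ∃ φ : Ω → ℝ, Measurable φ ∧ (∀ w, μ {ω | φ ω = w} = 0) ∧
      ∀ ω, φ ω ∈ Set.Icc (0 : ℝ) 1 := by
  obtain ⟨φ, -, hφ, -, hφμ, -⟩ := hμ
  have ha : AEMeasurable φ μ := hφ.aemeasurable
  refine ⟨fun ω => ((ha.mk φ ω : unitInterval) : ℝ), 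
    measurable_subtype_coe.comp ha.measurable_mk, fun w => ?_, fun ω => (ha.mk φ ω).2⟩
  have h1 : μ {ω | (φ ω : ℝ) = w} = 0 := by
    by_cases hw : w ∈ unitInterval
    · have h2 := hφμ {⟨w, hw⟩} (measurableSet_singleton _)
      rw [measure_singleton] at h2
      rw [← h2]
      congr 1
      ext ω
      simp [Subtype.ext_iff]
    · have : {ω | (φ ω : ℝ) = w} = ∅ :=
        Set.eq_empty_of_forall_notMem fun ω (h : (φ ω : ℝ) = w) => hw (h ▸ (φ ω).2)
      rw [this, measure_empty]
  rw [← h1]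
  refine measure_congr ?_
  filter_upwards [ha.ae_eq_mk] with ω hω
  exact propext (by change ((ha.mk φ ω : unitInterval) : ℝ) = w ↔ (φ ω : ℝ) = w; rw [hω])

/-- If s > a ρ², the bound s' ≤ 1 suffices. Otherwise a ρ^(k+3) < s ≤ a ρ^(k+2) for some k, and then
s' ≤ a ρ^k < s / ρ³. -/
lemma le_mul_of_level {a ρ s s' : ℝ} (ha : 0 < a) (hρ : 0 < ρ) (hρ1 : ρ < 1) (hs : 0 < s)
    (hs' : s' ≤ 1) (h : ∀ k : ℕ, s ≤ a * ρ ^ (k + 2) → s' ≤ a * ρ ^ k) :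
    s' ≤ (1 / (a * ρ ^ 2) + 1 / ρ ^ 3) * s := by
  have hp1 : 0 < 1 / (a * ρ ^ 2) := by positivity
  have hp2 : 0 < 1 / ρ ^ 3 := by positivity
  rcases lt_or_ge (a * ρ ^ 2) s with h1 | h1
  · have h2 : 1 ≤ 1 / (a * ρ ^ 2) * s := by
      rw [one_div, inv_mul_eq_div, one_le_div (by positivity)]
      exact h1.le
    have h3 : 0 < 1 / ρ ^ 3 * s := by positivity
    linarith
  · obtain ⟨k, hk1, hk2⟩ := exists_nat_pow_near_of_lt_one (x := s / (a * ρ ^ 2)) (y := ρ)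
      (by positivity) ((div_le_one (by positivity)).2 h1) hρ hρ1
    rw [lt_div_iff₀ (by positivity)] at hk1
    rw [div_le_iff₀ (by positivity)] at hk2
    have h2 := h k (by rw [pow_add]; linarith)
    have h3 : a * ρ ^ k ≤ 1 / ρ ^ 3 * s := by
      rw [one_div, inv_mul_eq_div, le_div_iff₀ (by positivity)]
      refine le_trans (le_of_eq ?_) hk1.le
      ring
    have h4 : 0 < 1 / (a * ρ ^ 2) * s := by positivity
    linarith

lemma exists_injective_code (α : Type*) [MeasurableSpace α] [StandardBorelSpace α] :
    ∃ ι : α → ℝ, Measurable ι ∧ Function.Injective ι ∧ ∀ x, ι x ∈ Set.Ico (0 : ℝ) 1 := by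
  have hg := measurableEmbedding_sigmoid_comp_embeddingReal α
  set g := unitInterval.sigmoid ∘ embeddingReal α
  -- Halving keeps the code away from 1, as `levelCode` requires.
  refine ⟨fun x => (g x : ℝ) / 2, (measurable_subtype_coe.comp hg.measurable).div_const 2,
    fun x y h => hg.injective (Subtype.ext (by simpa using h)), fun x => ⟨?_, ?_⟩⟩
  · have := (g x).2.1
    positivity
  · change (g x : ℝ) / 2 < 1
    linarith [(g x).2.2]

/-! ### Realizing a law with bounded gap by slowly varying angles -/

section Construction

variable {Ω : Type*} [MeasurableSpace Ω] {μ : Measure Ω} [IsProbabilityMeasure μ] {T : Ω ≃ᵐ Ω}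
  {η : Measure LinePairs} [IsProbabilityMeasure η]

/-- For a measure with bounded gap whose angles are not bounded below, the measures of the sets of
pairs with small angle decrease strictly along a geometric sequence of thresholds. -/
lemma exists_strictAnti_of_hasBoundedGap (hη : HasBoundedGap η)
    (hsmall : ∀ c : ℝ, 0 < c → η {p | sinAngle p ≤ c} ≠ 0) :
    ∃ a ρ : ℝ, 0 < a ∧ 0 < ρ ∧ ρ < 1 ∧
      StrictAnti fun k : ℕ => η.real {p | sinAngle p ≤ a * ρ ^ k} := by
  unfold HasBoundedGap HasUnboundedGap at hη
  push Not at hη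
  obtain ⟨ε, hε, hgap⟩ := hη
  obtain ⟨n, hn⟩ : ∃ n : ℕ, η {p | 1 / ((n : ℝ) + 1) < sinAngle p} ≠ 0 := by
    by_contra! h
    have h1 := measure_iUnion_null h
    have h2 : (⋃ n : ℕ, {p | 1 / ((n : ℝ) + 1) < sinAngle p}) = Set.univ :=
      Set.eq_univ_of_forall fun p => Set.mem_iUnion.2 (exists_nat_one_div_lt (sinAngle_pos p))
    rw [h2, measure_univ] at h1
    exact one_ne_zero h1
  have hρ : 0 < min ε (1 / 2) := by positivity
  have hρ1 : min ε (1 / 2) < 1 := (min_le_right _ _).trans_lt (by norm_num)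
  refine ⟨1 / ((n : ℝ) + 1), min ε (1 / 2), by positivity, hρ, hρ1, ?_⟩
  set a := 1 / ((n : ℝ) + 1)
  set ρ := min ε (1 / 2)
  have ha : 0 < a := by positivity
  refine strictAnti_nat_of_succ_lt fun k => ?_
  have hle : a * ρ ^ (k + 1) ≤ a * ρ ^ k :=
    mul_le_mul_of_nonneg_left (pow_le_pow_of_le_one hρ.le hρ1.le (Nat.le_succ k)) ha.le
  have hsub : {p | sinAngle p ≤ a * ρ ^ (k + 1)} ⊆ {p | sinAngle p ≤ a * ρ ^ k} :=
    fun p hp => le_trans hp hle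
  -- Equality would leave no mass between two consecutive thresholds. The two sides would then be
  -- separated by a factor ρ ≤ ε, which the choice of ε forbids.
  refine lt_of_le_of_ne (measureReal_mono hsub) fun heq => ?_
  have hA : MeasurableSet {p | sinAngle p ≤ a * ρ ^ (k + 1)} :=
    measurableSet_le measurable_sinAngle measurable_const
  have hB : MeasurableSet {p | a * ρ ^ k < sinAngle p} :=
    measurableSet_lt measurable_const measurable_sinAngle
  have hdisj : Disjoint {p | sinAngle p ≤ a * ρ ^ (k + 1)} {p | a * ρ ^ k < sinAngle p} :=
    Set.disjoint_left.2 fun p h1 h2 => absurd (le_trans h1 hle) (not_le.2 h2)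
  have hcompl : {p | a * ρ ^ k < sinAngle p} = {p | sinAngle p ≤ a * ρ ^ k}ᶜ := by
    ext p
    simp
  have hB0 : η {p | a * ρ ^ k < sinAngle p} ≠ 0 := fun h => hn (measure_mono_null
    (fun p hp => lt_of_le_of_lt (mul_le_of_le_one_right ha.le (pow_le_one₀ hρ.le hρ1.le)) hp) h)
  obtain ⟨x, hx, y, hy, hxy⟩ := hgap _ _ hA hB
    (pos_iff_ne_zero.2 (hsmall _ (by positivity))) (pos_iff_ne_zero.2 hB0) (by
      have h1 : η.real ({p | sinAngle p ≤ a * ρ ^ (k + 1)} ∪ {p | a * ρ ^ k < sinAngle p}) = 1 := by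
        rw [measureReal_union hdisj hB, heq, hcompl,
          probReal_compl_eq_one_sub (measurableSet_le measurable_sinAngle measurable_const)]
        ring
      rw [measureReal_def, ENNReal.toReal_eq_one_iff] at h1
      exact h1)
  rw [sin_pairAngle, sin_pairAngle] at hxy
  have h1 : sinAngle x ≤ a * ρ ^ (k + 1) := hx
  have h2 : a * ρ ^ k < sinAngle y := hy
  have h3 : ρ * sinAngle y ≤ ε * sinAngle y :=
    mul_le_mul_of_nonneg_right (min_le_left _ _) (sinAngle_pos y).le
  have h4 : ρ * (a * ρ ^ k) < ρ * sinAngle y := mul_lt_mul_of_pos_left h2 hρ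
  rw [pow_succ] at h1
  linarith

/-- A measure with bounded gap is the law of a family of line pairs whose angles change by a bounded
factor along the orbits. -/
theorem exists_linePairs_of_hasBoundedGap (hμ : IsNonatomicLebesgueSpace μ) (hT : Ergodic T μ)
    (hη : HasBoundedGap η) :
    ∃ E : Ω → LinePairs, Measurable E ∧ μ.map E = η ∧ ∃ K : ℝ, 0 < K ∧ ∀ᵐ ω ∂μ,
      sinAngle (E (T ω)) ≤ K * sinAngle (E ω) ∧ sinAngle (E ω) ≤ K * sinAngle (E (T ω)) := by
  obtain ⟨φ, hφ, hφ0, hφ01⟩ := exists_measurable_atomless hμ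
  obtain ⟨ι, hι, hιinj, hι01⟩ := exists_injective_code LinePairs
  have haeT : ∀ {p : Ω → Prop}, (∀ᵐ ω ∂μ, p ω) → ∀ᵐ ω ∂μ, p (T ω) := fun h =>
    hT.toMeasurePreserving.quasiMeasurePreserving.ae h
  by_cases hsmall : ∀ c : ℝ, 0 < c → η {p | sinAngle p ≤ c} ≠ 0
  · obtain ⟨a, ρ, ha, hρ, hρ1, hq⟩ := exists_strictAnti_of_hasBoundedGap hη hsmall
    let Q : ℕ → Set LinePairs := fun k => {p | sinAngle p ≤ a * ρ ^ k}
    have hQm : ∀ k, MeasurableSet (Q k) := fun k =>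
      measurableSet_le measurable_sinAngle measurable_const
    have hQanti : Antitone Q := fun i j hij p hp => le_trans hp
      (mul_le_mul_of_nonneg_left (pow_le_pow_of_le_one hρ.le hρ1.le hij) ha.le)
    have hpow : Tendsto (fun k : ℕ => a * ρ ^ k) atTop (𝓝 0) := by
      simpa using (tendsto_pow_atTop_nhds_zero_of_lt_one hρ.le hρ1).const_mul a
    have hQex : ∀ p, ∃ k, p ∉ Q k := fun p => by
      obtain ⟨k, hk⟩ := (hpow.eventually (gt_mem_nhds (sinAngle_pos p))).exists
      exact ⟨k, not_le.2 hk⟩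
    have hlim : Tendsto (fun k => η.real (Q k)) atTop (𝓝 0) := by
      have h1 := tendsto_measure_iInter_atTop (μ := η) (fun k => (hQm k).nullMeasurableSet) hQanti
        ⟨0, measure_ne_top _ _⟩
      have h2 : ⋂ k, Q k = ∅ := Set.eq_empty_of_forall_notMem fun p hp => by
        obtain ⟨k, hk⟩ := hQex p
        exact hk (Set.mem_iInter.1 hp k)
      rw [h2, measure_empty] at h1
      exact (ENNReal.tendsto_toReal ENNReal.zero_ne_top).comp h1
    obtain ⟨G, hGm, hGanti, hGT, hGex, hGq⟩ := exists_nested_sets hT hφ hφ0 hφ01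
      (q := fun k => η.real (Q k)) hq measureReal_le_one hlim
    have hφ2 : Measurable fun ω => φ ω / 2 := hφ.div_const 2
    have hφ20 : ∀ w, μ {ω | φ ω / 2 = w} = 0 := fun w => by
      rw [← hφ0 (2 * w)]
      congr 1
      ext ω
      exact ⟨fun (h : φ ω / 2 = w) => show φ ω = 2 * w by linarith,
        fun (h : φ ω = 2 * w) => show φ ω / 2 = w by linarith⟩
    have hφ201 : ∀ ω, φ ω / 2 ∈ Set.Ico (0 : ℝ) 1 := fun ω =>
      ⟨by linarith [(hφ01 ω).1], by linarith [(hφ01 ω).2]⟩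
    have hJ : MeasurableEmbedding (levelCode hQex ι) :=
      (measurable_levelCode hQm hQex hι).measurableEmbedding
        (levelCode_injective hQex hι01 hιinj)
    obtain ⟨E, hE, hEη, hE1, hE2⟩ := exists_map_eq_monotone
      (measurable_levelCode hGm hGex hφ2) (fun w => measure_levelCode_eq hGex hφ20 w) η hJ
    have hGset : ∀ k : ℕ, {ω | levelCode hGex (fun ω => φ ω / 2) ω ≤ -((k : ℝ) + 1)} = G k :=
      fun k => Set.ext fun ω => levelCode_le_iff hGanti hGex hφ201 ω k
    have hQset : ∀ k : ℕ, {p | levelCode hQex ι p ≤ -((k : ℝ) + 1)} = Q k :=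
      fun k => Set.ext fun ω => levelCode_le_iff hQanti hQex hι01 ω k
    have hGQ : ∀ᵐ ω ∂μ, ∀ k, ω ∈ G k → E ω ∈ Q k := ae_all_iff.2 fun k => by
      filter_upwards [hE1 (-((k : ℝ) + 1)) (-((k : ℝ) + 1)) (by
        rw [hGset, hQset]
        exact (ENNReal.toReal_le_toReal (measure_ne_top _ _) (measure_ne_top _ _)).1
          (hGq k).2)] with ω hω h
      exact (levelCode_le_iff hQanti hQex hι01 _ k).1
        (hω ((levelCode_le_iff hGanti hGex hφ201 ω k).2 h))
    have hQG : ∀ᵐ ω ∂μ, ∀ k, E ω ∈ Q (k + 1) → ω ∈ G k := ae_all_iff.2 fun k => by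
      filter_upwards [hE2 (-((k : ℝ) + 1)) (-(((k + 1 : ℕ) : ℝ) + 1)) (by
        rw [hGset, hQset]
        exact (ENNReal.toReal_le_toReal (measure_ne_top _ _) (measure_ne_top _ _)).1
          (hGq k).1)] with ω hω h
      exact (levelCode_le_iff hGanti hGex hφ201 ω k).1
        (hω ((levelCode_le_iff hQanti hQex hι01 _ (k + 1)).2 h))
    refine ⟨E, hE, hEη, 1 / (a * ρ ^ 2) + 1 / ρ ^ 3, by positivity, ?_⟩
    filter_upwards [hQG, haeT hQG, hGQ, haeT hGQ] with ω h1 h2 h3 h4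
    constructor
    · refine le_mul_of_level ha hρ hρ1 (sinAngle_pos _) (sinAngle_le_one _) fun k hk => ?_
      -- The chain is E ω ∈ Q (k+2), ω ∈ G (k+1), T ω ∈ G k, E (T ω) ∈ Q k.
      exact h4 k (hGT k ω (h1 (k + 1) hk)).1
    · refine le_mul_of_level ha hρ hρ1 (sinAngle_pos _) (sinAngle_le_one _) fun k hk => ?_
      have := (hGT k (T ω) (h2 (k + 1) hk)).2
      rw [T.symm_apply_apply] at this
      exact h3 k this
  -- When the angles are bounded below by c, any map with law η works, with factor 1 / c.
  · push Not at hsmall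
    obtain ⟨c, hc, hc0⟩ := hsmall
    obtain ⟨E, hE, hEη, -, -⟩ := exists_map_eq_monotone hφ hφ0 η
      (hι.measurableEmbedding hιinj)
    have hae : ∀ᵐ ω ∂μ, c ≤ sinAngle (E ω) := by
      have h1 : ∀ᵐ p ∂(μ.map E), c ≤ sinAngle p := by
        rw [hEη, ae_iff]
        exact measure_mono_null (fun p hp => (not_le.1 hp).le) hc0
      exact ae_of_ae_map hE.aemeasurable h1
    refine ⟨E, hE, hEη, 1 / c, by positivity, ?_⟩
    have key : ∀ p p' : LinePairs, c ≤ sinAngle p → sinAngle p' ≤ 1 / c * sinAngle p :=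
      fun p p' h => (sinAngle_le_one p').trans (by
        rw [one_div, inv_mul_eq_div, one_le_div hc]
        exact h)
    filter_upwards [hae, haeT hae] with ω h1 h2
    exact ⟨key _ _ h1, key _ _ h2⟩

end Construction

/-! ### Linear maps of the plane that carry one basis to another -/

/-- The matrix that maps `v` to `a v'` and `w` to `b w'`. -/
def transferMatrix (v w v' w' : Plane) (a b : ℝ) : Matrix (Fin 2) (Fin 2) ℝ :=
  fun i j => ![a * v' i * w 1 - b * w' i * v 1, b * w' i * v 0 - a * v' i * w 0] j / wedge v w

lemma det_transferMatrix {v w : Plane} (h : wedge v w ≠ 0) (v' w' : Plane) (a b : ℝ) :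
    (transferMatrix v w v' w' a b).det = a * b * wedge v' w' / wedge v w := by
  rw [Matrix.det_fin_two]
  simp only [transferMatrix, Matrix.cons_val_zero, Matrix.cons_val_one]
  rw [eq_div_iff h]
  field_simp
  unfold wedge
  ring

lemma toEuclideanLin_apply_coord (A : Matrix (Fin 2) (Fin 2) ℝ) (v : Plane) (i : Fin 2) :
    Matrix.toEuclideanLin A v i = A i 0 * v 0 + A i 1 * v 1 := by
  fin_cases i <;> simp [Matrix.toLpLin_apply]

lemma toEuclideanLin_transferMatrix_left {v w : Plane} (h : wedge v w ≠ 0) (v' w' : Plane)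
    (a b : ℝ) : Matrix.toEuclideanLin (transferMatrix v w v' w' a b) v = a • v' := by
  ext i
  rw [toEuclideanLin_apply_coord]
  simp only [transferMatrix, Matrix.cons_val_zero, Matrix.cons_val_one, PiLp.smul_apply,
    smul_eq_mul]
  field_simp
  unfold wedge
  ring

lemma toEuclideanLin_transferMatrix_right {v w : Plane} (h : wedge v w ≠ 0) (v' w' : Plane)
    (a b : ℝ) : Matrix.toEuclideanLin (transferMatrix v w v' w' a b) w = b • w' := by
  ext i
  rw [toEuclideanLin_apply_coord]
  simp only [transferMatrix, Matrix.cons_val_zero, Matrix.cons_val_one, PiLp.smul_apply,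
    smul_eq_mul]
  field_simp
  unfold wedge
  ring

lemma abs_coord_le_one {v : Plane} (hv : ‖v‖ = 1) (i : Fin 2) : |v i| ≤ 1 := by
  have := PiLp.norm_apply_le v i
  rwa [hv] at this

/-- If c is the cosine of the angle, |v - w|² = 2 (1 - c) ≤ 2 (1 - c²) = 2 sin², where c ≥ 0 is
essential: it excludes nearly opposite vectors. -/
lemma abs_sub_coord_le {v w : Plane} (hv : ‖v‖ = 1) (hw : ‖w‖ = 1) (h : 0 ≤ inner ℝ v w)
    (i : Fin 2) : |v i - w i| ≤ 2 * |wedge v w| := by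
  have hv2 := norm_sq_plane v
  have hw2 := norm_sq_plane w
  rw [hv] at hv2
  rw [hw] at hw2
  rw [inner_plane] at h
  have hlag : (v 0 * w 0 + v 1 * w 1) ^ 2 + wedge v w ^ 2 = 1 := by
    have : (v 0 * w 0 + v 1 * w 1) ^ 2 + wedge v w ^ 2 =
        (v 0 ^ 2 + v 1 ^ 2) * (w 0 ^ 2 + w 1 ^ 2) := by unfold wedge; ring
    rw [this, ← hv2, ← hw2]
    norm_num
  set c := v 0 * w 0 + v 1 * w 1
  have hc1 : c ≤ 1 := by nlinarith [sq_nonneg (wedge v w)]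
  have hsum : (v 0 - w 0) ^ 2 + (v 1 - w 1) ^ 2 = 2 - 2 * c := by
    simp only [c]
    linear_combination -hv2 - hw2
  have hi : (v i - w i) ^ 2 ≤ (v 0 - w 0) ^ 2 + (v 1 - w 1) ^ 2 := by
    fin_cases i
    · exact le_add_of_nonneg_right (sq_nonneg _)
    · exact le_add_of_nonneg_left (sq_nonneg _)
  have h3 : (v i - w i) ^ 2 ≤ (2 * |wedge v w|) ^ 2 := by
    rw [mul_pow, sq_abs]
    nlinarith
  exact abs_le_of_sq_le_sq h3 (by positivity)

lemma abs_transferMatrix_le_of_wedge {v w v' w' : Plane} (hv : ‖v‖ = 1) (hw : ‖w‖ = 1)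
    (hv' : ‖v'‖ = 1) (hw' : ‖w'‖ = 1) {a b L δ : ℝ} (ha : |a| ≤ L) (hb : |b| ≤ L) (hδ : 0 < δ)
    (h : δ ≤ |wedge v w|) (i j : Fin 2) : |transferMatrix v w v' w' a b i j| ≤ 2 * L / δ := by
  have hL : 0 ≤ L := (abs_nonneg a).trans ha
  have key : ∀ x y z t : ℝ, |x| ≤ 1 → |y| ≤ 1 → |z| ≤ 1 → |t| ≤ 1 →
      |(a * x * y - b * z * t) / wedge v w| ≤ 2 * L / δ := by
    intro x y z t hx hy hz ht
    rw [abs_div]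
    refine div_le_div₀ (by positivity) ?_ hδ h
    refine (abs_sub _ _).trans ?_
    rw [abs_mul, abs_mul, abs_mul, abs_mul]
    have h1 : |a| * |x| * |y| ≤ L * 1 * 1 := by gcongr
    have h2 : |b| * |z| * |t| ≤ L * 1 * 1 := by gcongr
    linarith
  fin_cases j
  · exact key _ _ _ _ (abs_coord_le_one hv' i) (abs_coord_le_one hw 1) (abs_coord_le_one hw' i)
      (abs_coord_le_one hv 1)
  · have := key _ _ _ _ (abs_coord_le_one hv' i) (abs_coord_le_one hw 0) (abs_coord_le_one hw' i)
      (abs_coord_le_one hv 0)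
    rw [← abs_neg, ← neg_div, neg_sub] at this
    exact this

/-- With equal stretch factors the numerators v' i w j - w' i v j are combinations of v - w and v' -
w', hence of the order of the two sines. This cancels the small denominator and gives a bound that
does not depend on the angle. -/
lemma abs_transferMatrix_le_of_ratio {v w v' w' : Plane} (hv : ‖v‖ = 1) (hw : ‖w‖ = 1)
    (hv' : ‖v'‖ = 1) (hw' : ‖w'‖ = 1) (hvw : 0 ≤ inner ℝ v w) (hvw' : 0 ≤ inner ℝ v' w')
    (h0 : wedge v w ≠ 0) {K : ℝ} (hK : |wedge v' w'| ≤ K * |wedge v w|) (i j : Fin 2) :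
    |transferMatrix v w v' w' 1 1 i j| ≤ 2 * (1 + K) := by
  have key : ∀ j, |(1 * v' i * w j - 1 * w' i * v j) / wedge v w| ≤ 2 * (1 + K) := by
    intro j
    rw [abs_div, div_le_iff₀ (abs_pos.2 h0)]
    have h1 : 1 * v' i * w j - 1 * w' i * v j =
        v' i * -(v j - w j) + v j * (v' i - w' i) := by ring
    rw [h1]
    refine (abs_add_le _ _).trans ?_
    rw [abs_mul, abs_mul, abs_neg]
    have h2 : |v' i| * |v j - w j| ≤ 1 * (2 * |wedge v w|) := by
      gcongr
      · exact abs_coord_le_one hv' i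
      · exact abs_sub_coord_le hv hw hvw j
    have h3 : |v j| * |v' i - w' i| ≤ 1 * (2 * |wedge v' w'|) := by
      gcongr
      · exact abs_coord_le_one hv j
      · exact abs_sub_coord_le hv' hw' hvw' i
    nlinarith
  fin_cases j
  · exact key 1
  · have := key 0
    rw [← abs_neg, ← neg_div, neg_sub] at this
    exact this

lemma wedge_toEuclideanLin (A : Matrix (Fin 2) (Fin 2) ℝ) (v w : Plane) :
    wedge (Matrix.toEuclideanLin A v) (Matrix.toEuclideanLin A w) = A.det * wedge v w := by
  unfold wedge
  rw [Matrix.det_fin_two]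
  simp only [toEuclideanLin_apply_coord]
  ring

lemma measurable_transferMatrix {β : Type*} [MeasurableSpace β] {v w v' w' : β → Plane}
    {a b : β → ℝ} (hv : Measurable v) (hw : Measurable w) (hv' : Measurable v')
    (hw' : Measurable w') (ha : Measurable a) (hb : Measurable b) (i j : Fin 2) :
    Measurable fun x => transferMatrix (v x) (w x) (v' x) (w' x) (a x) (b x) i j := by
  have hc : ∀ {f : β → Plane}, Measurable f → ∀ i, Measurable fun x => f x i :=
    fun hf i => (measurable_coord i).comp hf
  fin_cases j
  · exact (((ha.mul (hc hv' i)).mul (hc hw 1)).sub ((hb.mul (hc hw' i)).mul (hc hv 1))).div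
      (measurable_wedge hv hw)
  · exact (((hb.mul (hc hw' i)).mul (hc hv 0)).sub ((ha.mul (hc hv' i)).mul (hc hw 0))).div
      (measurable_wedge hv hw)

/-! ### The topology of the general linear group -/

/-- The topology of the units also records the inverse; it is the subspace topology because matrix
inversion is continuous where the determinant does not vanish. -/
lemma isEmbedding_coe_GL :
    IsEmbedding (Units.val : GL (Fin 2) ℝ → Matrix (Fin 2) (Fin 2) ℝ) := by
  refine Units.isEmbedding_val_mk' (f := fun A => A⁻¹) (fun A hA => ?_) fun u =>
    (Matrix.coe_units_inv u).symm
  have hdet : A.det ≠ 0 := ((Matrix.isUnit_iff_isUnit_det A).1 hA).ne_zero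
  refine ContinuousAt.continuousWithinAt (continuousAt_matrix_inv A ?_)
  rw [Ring.inverse_eq_inv']
  exact continuousAt_inv₀ hdet

lemma measurable_GL_of_coord {β : Type*} [MeasurableSpace β] {F : β → GL (Fin 2) ℝ}
    (hF : ∀ i j, Measurable fun x => (F x : Matrix (Fin 2) (Fin 2) ℝ) i j) :
    Measurable[_, borel (GL (Fin 2) ℝ)] F := by
  have h1 : borel (GL (Fin 2) ℝ) = MeasurableSpace.comap
      (Units.val : GL (Fin 2) ℝ → Matrix (Fin 2) (Fin 2) ℝ) (borel _) := by
    rw [isEmbedding_coe_GL.eq_induced]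
    exact borel_comap
  rw [h1, measurable_comap_iff]
  have h2 : borel (Matrix (Fin 2) (Fin 2) ℝ) = (inferInstance : MeasurableSpace
      (Fin 2 → Fin 2 → ℝ)) := (BorelSpace.measurable_eq (α := Fin 2 → Fin 2 → ℝ)).symm
  rw [h2]
  exact measurable_pi_iff.2 fun i => measurable_pi_iff.2 fun j => hF i j

lemma isBoundedMap_of_coord {β : Type*} {F : β → GL (Fin 2) ℝ} {C c : ℝ}
    (hc : 0 < c) (hF : ∀ x i j, |(F x : Matrix (Fin 2) (Fin 2) ℝ) i j| ≤ C)
    (hdet : ∀ x, c ≤ |(F x : Matrix (Fin 2) (Fin 2) ℝ).det|) : IsBoundedMap F := by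
  let S : Set (Matrix (Fin 2) (Fin 2) ℝ) :=
    (Set.univ.pi fun _ => Set.univ.pi fun _ => Set.Icc (-C) C) ∩ {A | c ≤ |A.det|}
  have hS : IsCompact S := by
    refine IsCompact.inter_right
      (isCompact_univ_pi fun _ => isCompact_univ_pi fun _ => isCompact_Icc) ?_
    exact isClosed_le continuous_const (continuous_abs.comp (continuous_id.matrix_det))
  have hS' : S ⊆ Set.range (Units.val : GL (Fin 2) ℝ → Matrix (Fin 2) (Fin 2) ℝ) := by
    intro A hA
    have hA' : A.det ≠ 0 := abs_pos.1 (hc.trans_le hA.2)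
    exact ⟨Matrix.GeneralLinearGroup.mkOfDetNeZero A hA', rfl⟩
  have hK := isEmbedding_coe_GL.isInducing.isCompact_preimage' hS hS'
  have : T2Space (GL (Fin 2) ℝ) := isEmbedding_coe_GL.t2Space
  refine hK.closure_of_subset ?_
  rintro _ ⟨x, rfl⟩
  refine ⟨Set.mem_univ_pi.2 fun i => Set.mem_univ_pi.2 fun j => ?_, hdet x⟩
  exact abs_le.1 (hF x i j)

/-! ### The cocycle -/

/-- A unit vector on the second line of a pair, at an acute angle with the unit vector on the first
line. -/
def acuteUnit (p : LinePairs) : Plane :=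
  if 0 ≤ (inner ℝ p.1.1.unit p.1.2.unit : ℝ) then p.1.2.unit else -p.1.2.unit

lemma acuteUnit_eq_or (p : LinePairs) :
    acuteUnit p = p.1.2.unit ∨ acuteUnit p = -p.1.2.unit := by
  unfold acuteUnit
  split_ifs
  · exact Or.inl rfl
  · exact Or.inr rfl

lemma norm_acuteUnit (p : LinePairs) : ‖acuteUnit p‖ = 1 := by
  rcases acuteUnit_eq_or p with h | h <;> rw [h]
  · exact p.1.2.norm_unit
  · rw [norm_neg]
    exact p.1.2.norm_unit

lemma inner_acuteUnit_nonneg (p : LinePairs) : 0 ≤ (inner ℝ p.1.1.unit (acuteUnit p) : ℝ) := by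
  unfold acuteUnit
  split_ifs with h
  · exact h
  · rw [inner_neg_right]
    linarith [not_le.1 h]

lemma abs_wedge_acuteUnit (p : LinePairs) : |wedge p.1.1.unit (acuteUnit p)| = sinAngle p := by
  rcases acuteUnit_eq_or p with h | h <;> rw [h]
  · rfl
  · have := wedge_smul_smul 1 (-1) p.1.1.unit p.1.2.unit
    rw [one_smul, neg_one_smul] at this
    rw [this, sinAngle, abs_mul]
    simp

lemma wedge_acuteUnit_ne_zero (p : LinePairs) : wedge p.1.1.unit (acuteUnit p) ≠ 0 := by
  rw [← abs_pos, abs_wedge_acuteUnit]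
  exact sinAngle_pos p

lemma measurable_acuteUnit : Measurable acuteUnit := by
  refine Measurable.ite ?_ measurable_unit_snd measurable_unit_snd.neg
  exact measurableSet_le measurable_const (measurable_unit_fst.inner measurable_unit_snd)

section Cocycle

variable {Ω : Type*} [MeasurableSpace Ω] {μ : Measure Ω} {T : Ω ≃ᵐ Ω}

open Classical in
/-- A bounded cocycle that preserves a family of line pairs of variable angle, and stretches the
lines by `exp c₁` and `exp c₂` at the points where the angle is not small. -/
theorem exists_cocycle_of_linePairs {E : Ω → LinePairs} (hE : Measurable E) {K : ℝ} (hK0 : 0 < K)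
    (hK : ∀ᵐ ω ∂μ, sinAngle (E (T ω)) ≤ K * sinAngle (E ω) ∧
      sinAngle (E ω) ≤ K * sinAngle (E (T ω))) {δ : ℝ} (hδ : 0 < δ) (c₁ c₂ : ℝ) :
    ∃ F : Ω → GL (Fin 2) ℝ, Measurable[_, borel (GL (Fin 2) ℝ)] F ∧ IsBoundedMap F ∧
      ∀ᵐ ω ∂μ,
        act (F ω) (E ω).1.1.unit =
          Real.exp (Set.indicator {ω | δ ≤ sinAngle (E ω)} (fun _ => c₁) ω) •
            (E (T ω)).1.1.unit ∧
        act (F ω) (acuteUnit (E ω)) =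
          Real.exp (Set.indicator {ω | δ ≤ sinAngle (E ω)} (fun _ => c₂) ω) •
            acuteUnit (E (T ω)) := by
  set P : Set Ω := {ω | δ ≤ sinAngle (E ω)} with hP
  have hPm : MeasurableSet P := measurableSet_le measurable_const (measurable_sinAngle.comp hE)
  have hET : Measurable fun ω => E (T ω) := hE.comp T.measurable
  let D : Set Ω := {ω | sinAngle (E (T ω)) ≤ K * sinAngle (E ω) ∧
      sinAngle (E ω) ≤ K * sinAngle (E (T ω))}
  have hD : MeasurableSet D :=
    (measurableSet_le (measurable_sinAngle.comp hET)
      ((measurable_sinAngle.comp hE).const_mul K)).inter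
    (measurableSet_le (measurable_sinAngle.comp hE)
      ((measurable_sinAngle.comp hET).const_mul K))
  let a : ℝ → Ω → ℝ := fun c ω => Real.exp (P.indicator (fun _ => c) ω)
  have ham : ∀ c, Measurable (a c) := fun c =>
    Real.measurable_exp.comp (measurable_const.indicator hPm)
  let A : Ω → Matrix (Fin 2) (Fin 2) ℝ := fun ω =>
    transferMatrix (E ω).1.1.unit (acuteUnit (E ω)) (E (T ω)).1.1.unit (acuteUnit (E (T ω)))
      (a c₁ ω) (a c₂ ω)
  have hAdet : ∀ ω, |(A ω).det| = a c₁ ω * a c₂ ω * (sinAngle (E (T ω)) / sinAngle (E ω)) := by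
    intro ω
    rw [det_transferMatrix (wedge_acuteUnit_ne_zero _), abs_div, abs_mul, abs_wedge_acuteUnit,
      abs_wedge_acuteUnit, abs_of_nonneg (by positivity), mul_div_assoc]
  have hAdet0 : ∀ ω, (A ω).det ≠ 0 := fun ω => by
    rw [← abs_pos, hAdet]
    have := sinAngle_pos (E ω)
    have := sinAngle_pos (E (T ω))
    positivity
  -- Boundedness is required at every point, whereas the control of the angles holds almost
  -- everywhere; hence the identity off D.
  let F : Ω → GL (Fin 2) ℝ := fun ω =>
    if ω ∈ D then Matrix.GeneralLinearGroup.mkOfDetNeZero (A ω) (hAdet0 ω) else 1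
  have hFD : ∀ ω ∈ D, (F ω : Matrix (Fin 2) (Fin 2) ℝ) = A ω := fun ω hω => by
    simp only [F, if_pos hω]
    rfl
  have hFD' : ∀ ω ∉ D, F ω = 1 := fun ω hω => by simp only [F, if_neg hω]
  let L := Real.exp (|c₁| + |c₂|)
  have hale : ∀ c, |c| ≤ |c₁| + |c₂| → ∀ ω, L⁻¹ ≤ a c ω ∧ a c ω ≤ L := by
    intro c hc ω
    have hc' := abs_le.1 hc
    have h0 : 0 ≤ |c₁| + |c₂| := by positivity
    simp only [a, L, ← Real.exp_neg, Real.exp_le_exp]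
    by_cases hω : ω ∈ P
    · rw [Set.indicator_of_mem hω]
      exact hc'
    · rw [Set.indicator_of_notMem hω]
      exact ⟨by linarith, h0⟩
  have ha1 := hale c₁ (le_add_of_nonneg_right (abs_nonneg _))
  have ha2 := hale c₂ (le_add_of_nonneg_left (abs_nonneg _))
  have hL : 0 < L := Real.exp_pos _
  refine ⟨F, measurable_GL_of_coord fun i j => ?_,
    -- The entries are bounded by the first summand on P and by the second off P. The determinant is
    -- the product of the two stretches, each at least L⁻¹, and of a ratio of sines that is at least
    -- K⁻¹ in absolute value.
    isBoundedMap_of_coord (C := 2 * L / δ + 2 * (1 + K)) (c := min 1 (L⁻¹ * L⁻¹ * K⁻¹))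
      (by positivity) (fun ω i j => ?_) fun ω => ?_, ?_⟩
  · have h1 : (fun ω => (F ω : Matrix (Fin 2) (Fin 2) ℝ) i j) =
        fun ω => if ω ∈ D then A ω i j else (1 : Matrix (Fin 2) (Fin 2) ℝ) i j := by
      funext ω
      split_ifs with h
      · rw [hFD ω h]
      · rw [hFD' ω h]
        rfl
    rw [h1]
    exact Measurable.ite hD (measurable_transferMatrix (measurable_unit_fst.comp hE)
      (measurable_acuteUnit.comp hE) (measurable_unit_fst.comp hET)
      (measurable_acuteUnit.comp hET) (ham c₁) (ham c₂) i j) measurable_const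
  · have hn1 : 0 ≤ 2 * L / δ := by positivity
    by_cases hω : ω ∈ D
    · rw [hFD ω hω]
      by_cases hωP : ω ∈ P
      · have := abs_transferMatrix_le_of_wedge (E ω).1.1.norm_unit (norm_acuteUnit (E ω))
          (E (T ω)).1.1.norm_unit (norm_acuteUnit (E (T ω))) (a := a c₁ ω) (b := a c₂ ω)
          (L := L) (δ := δ) (by rw [abs_of_pos (Real.exp_pos _)]; exact (ha1 ω).2)
          (by rw [abs_of_pos (Real.exp_pos _)]; exact (ha2 ω).2) hδ
          (by rw [abs_wedge_acuteUnit]; exact hωP) i j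
        exact this.trans (le_add_of_nonneg_right (by positivity))
      · have h1 : ∀ c, a c ω = 1 := fun c => by
          simp only [a, Set.indicator_of_notMem hωP, Real.exp_zero]
        have := abs_transferMatrix_le_of_ratio (E ω).1.1.norm_unit (norm_acuteUnit (E ω))
          (E (T ω)).1.1.norm_unit (norm_acuteUnit (E (T ω))) (inner_acuteUnit_nonneg _)
          (inner_acuteUnit_nonneg _) (wedge_acuteUnit_ne_zero _) (K := K)
          (by rw [abs_wedge_acuteUnit, abs_wedge_acuteUnit]; exact hω.1) i j
        simp only [A, h1]
        exact this.trans (le_add_of_nonneg_left hn1)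
    · rw [hFD' ω hω]
      have : |(1 : Matrix (Fin 2) (Fin 2) ℝ) i j| ≤ 1 := by
        rw [Matrix.one_apply]
        split_ifs <;> simp
      exact this.trans (by linarith)
  · by_cases hω : ω ∈ D
    · rw [hFD ω hω, hAdet]
      refine (min_le_right _ _).trans ?_
      have h1 : K⁻¹ ≤ sinAngle (E (T ω)) / sinAngle (E ω) := by
        rw [le_div_iff₀ (sinAngle_pos _), inv_mul_le_iff₀ hK0]
        exact hω.2
      have h2 := (ha1 ω).1
      have h3 := (ha2 ω).1
      have h4 : 0 < a c₁ ω := Real.exp_pos _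
      gcongr
    · rw [hFD' ω hω]
      simp
  · filter_upwards [hK] with ω hω
    have h := hFD ω hω
    constructor
    · rw [act, h]
      exact toEuclideanLin_transferMatrix_left (wedge_acuteUnit_ne_zero _) _ _ _ _
    · rw [act, h]
      exact toEuclideanLin_transferMatrix_right (wedge_acuteUnit_ne_zero _) _ _ _ _

end Cocycle

/-! ### Singular values in the plane -/

lemma finrank_plane : Module.finrank ℝ Plane = 2 := by simp

lemma det_act (g : GL (Fin 2) ℝ) :
    LinearMap.det (act g) = (g : Matrix (Fin 2) (Fin 2) ℝ).det := by
  exact LinearMap.det_toLpLin 2 _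

lemma singularValues_mul (f : Plane →ₗ[ℝ] Plane) :
    f.singularValues 0 * f.singularValues 1 = |LinearMap.det f| := by
  have h := f.normDet_eq_prod_singularValues
  rw [f.normDet_eq_norm_det, finrank_plane, Finset.prod_range_succ, Finset.prod_range_one] at h
  exact h.symm

/-- Both sides are the trace of f* f. This makes the first singular value comparable with norms of
images up to constants, which is enough for growth rates. -/
lemma sq_singularValues_add (f : Plane →ₗ[ℝ] Plane) :
    f.singularValues 0 ^ 2 + f.singularValues 1 ^ 2 =
      ‖f (EuclideanSpace.single 0 1)‖ ^ 2 + ‖f (EuclideanSpace.single 1 1)‖ ^ 2 := by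
  have h1 := f.isSymmetric_adjoint_comp_self.trace_eq_sum_eigenvalues finrank_plane
  rw [LinearMap.trace_eq_sum_inner _ (EuclideanSpace.basisFun (Fin 2) ℝ), Fin.sum_univ_two] at h1
  simp only [EuclideanSpace.basisFun_apply, LinearMap.comp_apply, LinearMap.adjoint_inner_right,
    real_inner_self_eq_norm_sq, RCLike.ofReal_real_eq_id, id_eq] at h1
  rw [Fin.sum_univ_two, ← f.sq_singularValues_fin finrank_plane,
    ← f.sq_singularValues_fin finrank_plane] at h1
  exact h1.symm

lemma norm_sq_le_two_mul_sq_singularValues (f : Plane →ₗ[ℝ] Plane) {v : Plane} (hv : ‖v‖ = 1) :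
    ‖f v‖ ^ 2 ≤ 2 * f.singularValues 0 ^ 2 := by
  have h1 := sq_singularValues_add f
  have h2 : f.singularValues 1 ≤ f.singularValues 0 := f.singularValues_antitone zero_le_one
  have h3 := f.singularValues_nonneg 1
  have h4 : f.singularValues 1 ^ 2 ≤ f.singularValues 0 ^ 2 := by gcongr
  have hv' : v = v 0 • EuclideanSpace.single 0 (1 : ℝ) + v 1 • EuclideanSpace.single 1 (1 : ℝ) := by
    ext i
    fin_cases i <;> simp
  have h5 : ‖f v‖ ≤ |v 0| * ‖f (EuclideanSpace.single 0 1)‖ +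
      |v 1| * ‖f (EuclideanSpace.single 1 1)‖ := by
    conv_lhs => rw [hv', map_add, map_smul, map_smul]
    refine (norm_add_le _ _).trans (le_of_eq ?_)
    rw [norm_smul, norm_smul, Real.norm_eq_abs, Real.norm_eq_abs]
  have h6 := norm_sq_plane v
  rw [hv, ← sq_abs (v 0), ← sq_abs (v 1)] at h6
  set a := |v 0|
  set b := |v 1|
  set x := ‖f (EuclideanSpace.single 0 1)‖
  set y := ‖f (EuclideanSpace.single 1 1)‖
  have h7 : ‖f v‖ ^ 2 ≤ (a * x + b * y) ^ 2 := by gcongr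
  have h8 : (a * x + b * y) ^ 2 + (a * y - b * x) ^ 2 = x ^ 2 + y ^ 2 := by
    have : (a * x + b * y) ^ 2 + (a * y - b * x) ^ 2 = (a ^ 2 + b ^ 2) * (x ^ 2 + y ^ 2) := by ring
    rw [this, ← h6]
    ring
  nlinarith [sq_nonneg (a * y - b * x)]

lemma eq_wedge_combination {v w : Plane} (h : wedge v w ≠ 0) (x : Plane) :
    x = (wedge x w / wedge v w) • v + (wedge v x / wedge v w) • w := by
  ext i
  simp only [PiLp.add_apply, PiLp.smul_apply, smul_eq_mul]
  rw [div_mul_eq_mul_div, div_mul_eq_mul_div, ← add_div, eq_div_iff h]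
  unfold wedge
  fin_cases i <;> simp <;> ring

lemma abs_wedge_le {v w : Plane} (hv : ‖v‖ = 1) (hw : ‖w‖ = 1) : |wedge v w| ≤ 1 := by
  have h1 := norm_sq_plane v
  have h2 := norm_sq_plane w
  rw [hv] at h1
  rw [hw] at h2
  have h3 : wedge v w ^ 2 + (v 0 * w 0 + v 1 * w 1) ^ 2 = 1 := by
    have : wedge v w ^ 2 + (v 0 * w 0 + v 1 * w 1) ^ 2 =
        (v 0 ^ 2 + v 1 ^ 2) * (w 0 ^ 2 + w 1 ^ 2) := by unfold wedge; ring
    rw [this, ← h1, ← h2]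
    norm_num
  exact abs_le_one_iff_mul_self_le_one.2 (by nlinarith [sq_nonneg (v 0 * w 0 + v 1 * w 1)])

/-- A unit vector has coordinates of absolute value at most 1 / |wedge v w| in the basis v, w. -/
lemma sq_singularValues_le (f : Plane →ₗ[ℝ] Plane) {v w : Plane} (hv : ‖v‖ = 1) (hw : ‖w‖ = 1)
    (h : wedge v w ≠ 0) :
    f.singularValues 0 ^ 2 ≤ 2 * ((‖f v‖ + ‖f w‖) / |wedge v w|) ^ 2 := by
  have key : ∀ x : Plane, ‖x‖ = 1 → ‖f x‖ ^ 2 ≤ ((‖f v‖ + ‖f w‖) / |wedge v w|) ^ 2 := by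
    intro x hx
    have h1 : ‖f x‖ ≤ (‖f v‖ + ‖f w‖) / |wedge v w| := by
      conv_lhs => rw [eq_wedge_combination h x, map_add, map_smul, map_smul]
      refine (norm_add_le _ _).trans ?_
      rw [norm_smul, norm_smul, Real.norm_eq_abs, Real.norm_eq_abs, abs_div, abs_div, add_div,
        div_mul_eq_mul_div, div_mul_eq_mul_div]
      have h2 := abs_wedge_le hx hw
      have h3 := abs_wedge_le hv hx
      gcongr
      · exact mul_le_of_le_one_left (norm_nonneg _) h2
      · exact mul_le_of_le_one_left (norm_nonneg _) h3
    gcongr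
  have h1 := sq_singularValues_add f
  have h2 := key (EuclideanSpace.single 0 1) (by simp)
  have h3 := key (EuclideanSpace.single 1 1) (by simp)
  nlinarith [sq_nonneg (f.singularValues 1)]

/-! ### Exponential growth rates -/

lemma tendsto_div_of_bounded_sub {x y : ℕ → ℝ} {C r : ℝ} (hxy : ∀ n, |x n - y n| ≤ C)
    (hy : Tendsto (fun n : ℕ => 1 / (n : ℝ) * y n) atTop (𝓝 r)) :
    Tendsto (fun n : ℕ => 1 / (n : ℝ) * x n) atTop (𝓝 r) := by
  have h0 : Tendsto (fun n : ℕ => 1 / (n : ℝ) * (x n - y n)) atTop (𝓝 0) := by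
    refine squeeze_zero_norm (a := fun n : ℕ => 1 / (n : ℝ) * C) (fun n => ?_) ?_
    · rw [norm_mul, Real.norm_eq_abs, Real.norm_eq_abs, abs_of_nonneg (by positivity)]
      exact mul_le_mul_of_nonneg_left (hxy n) (by positivity)
    · simpa using tendsto_one_div_atTop_nhds_zero_nat.mul_const C
  have := h0.add hy
  rw [zero_add] at this
  exact this.congr fun n => by ring

/-- Since a n - b n grows like n (r₁ - r₂), the second term is eventually at most half of the first,
so N n ≥ (α / 2) exp (a n). The constant D is the lead of a n over b n that ensures this. -/
lemma growth_rate_le_of_dominant {a b N : ℕ → ℝ} {α β r₁ r₂ r : ℝ} (hα : 0 < α) (hβ : 0 ≤ β)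
    (hN : ∀ n, α * Real.exp (a n) - β * Real.exp (b n) ≤ N n)
    (ha : Tendsto (fun n : ℕ => 1 / (n : ℝ) * a n) atTop (𝓝 r₁))
    (hb : Tendsto (fun n : ℕ => 1 / (n : ℝ) * b n) atTop (𝓝 r₂)) (hr : r₂ < r₁)
    (hlog : Tendsto (fun n : ℕ => 1 / (n : ℝ) * Real.log (N n)) atTop (𝓝 r)) : r₁ ≤ r := by
  set D := Real.log (2 * (β + 1) / α)
  have hsub : Tendsto (fun n : ℕ => 1 / (n : ℝ) * (a n - b n - D)) atTop (𝓝 (r₁ - r₂)) := by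
    have := (ha.sub hb).sub (tendsto_one_div_atTop_nhds_zero_nat.mul_const D)
    rw [zero_mul, sub_zero] at this
    exact this.congr fun n => by ring
  have hlow : Tendsto (fun n : ℕ => 1 / (n : ℝ) * (Real.log (α / 2) + a n)) atTop (𝓝 r₁) :=
    tendsto_div_of_bounded_sub (C := |Real.log (α / 2)|) (fun n => by simp) ha
  refine le_of_tendsto_of_tendsto hlow hlog ?_
  filter_upwards [hsub.eventually (lt_mem_nhds (sub_pos.2 hr)), eventually_gt_atTop 0]
    with n hn hn0
  have hn0' : (0 : ℝ) < n := by exact_mod_cast hn0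
  refine mul_le_mul_of_nonneg_left ?_ (by positivity)
  have h1 : D + b n < a n := by
    have := (mul_pos_iff_of_pos_left (by positivity)).1 hn
    linarith
  have h2 : 2 * (β + 1) / α * Real.exp (b n) ≤ Real.exp (a n) := by
    rw [← Real.exp_log (show 0 < 2 * (β + 1) / α by positivity), ← Real.exp_add]
    exact Real.exp_le_exp.2 h1.le
  have h3 : β * Real.exp (b n) ≤ α / 2 * Real.exp (a n) := by
    have h4 : (β + 1) * Real.exp (b n) ≤ α / 2 * Real.exp (a n) := by
      calc (β + 1) * Real.exp (b n) = α / 2 * (2 * (β + 1) / α * Real.exp (b n)) := by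
            field_simp
        _ ≤ _ := by gcongr
    nlinarith [Real.exp_pos (b n)]
  have h4 : α / 2 * Real.exp (a n) ≤ N n := by
    have := hN n
    linarith
  have h5 := Real.log_le_log (by positivity) h4
  rwa [Real.log_mul (by positivity) (Real.exp_ne_zero _), Real.log_exp] at h5

lemma tendsto_int_iff {β : Type*} {f : ℤ → β} {l : Filter β} :
    Tendsto f (atTop ⊔ atBot) l ↔
      Tendsto (fun n : ℕ => f n) atTop l ∧ Tendsto (fun n : ℕ => f (-(n : ℤ))) atTop l := by
  rw [tendsto_sup, ← map_neg_atTop, tendsto_map'_iff, ← Nat.map_cast_int_atTop, tendsto_map'_iff,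
    tendsto_map'_iff]
  rfl

/-- The vectors whose images under the maps `A n` have growth rate `r` for `n → ±∞`. -/
def growthSpace (A : ℤ → Plane →ₗ[ℝ] Plane) (r : ℝ) : Set Plane :=
  {x | Tendsto (fun n : ℤ => 1 / (n : ℝ) * Real.log ‖A n x‖) (atTop ⊔ atBot) (𝓝 r) ∨ x = 0}

section GrowthSpace

variable {A : ℤ → Plane →ₗ[ℝ] Plane} {v w : Plane} {a b : ℤ → ℝ} {r₁ r₂ r : ℝ}

lemma smul_mem_growthSpace (hv : ∀ n, ‖A n v‖ = Real.exp (a n))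
    (ha : Tendsto (fun n : ℤ => 1 / (n : ℝ) * a n) (atTop ⊔ atBot) (𝓝 r)) (c : ℝ) :
    c • v ∈ growthSpace A r := by
  rcases eq_or_ne c 0 with rfl | hc
  · exact Or.inr (zero_smul _ _)
  left
  have h : ∀ n : ℤ, 1 / (n : ℝ) * Real.log ‖A n (c • v)‖ =
      1 / (n : ℝ) * Real.log |c| + 1 / (n : ℝ) * a n := fun n => by
    rw [map_smul, norm_smul, hv, Real.norm_eq_abs,
      Real.log_mul (abs_ne_zero.2 hc) (Real.exp_ne_zero _), Real.log_exp]
    ring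
  simp_rw [h]
  have h0 : Tendsto (fun n : ℤ => 1 / (n : ℝ) * Real.log |c|) (atTop ⊔ atBot) (𝓝 0) := by
    rw [tendsto_int_iff]
    have h1 := tendsto_one_div_atTop_nhds_zero_nat.mul_const (Real.log |c|)
    rw [zero_mul] at h1
    constructor
    · simpa using h1
    · have h2 := h1.neg
      rw [neg_zero] at h2
      refine h2.congr fun n => ?_
      push_cast
      rw [one_div_neg_eq_neg_one_div]
      ring
  simpa using h0.add ha

lemma norm_combination_ge (hv : ∀ n, ‖A n v‖ = Real.exp (a n))
    (hw : ∀ n, ‖A n w‖ = Real.exp (b n)) (c d : ℝ) (n : ℤ) :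
    |c| * Real.exp (a n) - |d| * Real.exp (b n) ≤ ‖A n (c • v + d • w)‖ := by
  rw [map_add, map_smul, map_smul, ← hv, ← hw, ← Real.norm_eq_abs, ← Real.norm_eq_abs,
    ← norm_smul, ← norm_smul]
  exact norm_sub_le_norm_add _ _

lemma tendsto_neg_of_tendsto {f : ℤ → ℝ}
    (h : Tendsto (fun n : ℤ => 1 / (n : ℝ) * f n) (atTop ⊔ atBot) (𝓝 r)) :
    Tendsto (fun n : ℕ => 1 / (n : ℝ) * f (-(n : ℤ))) atTop (𝓝 (-r)) := by
  refine (tendsto_int_iff.1 h).2.neg.congr fun n => ?_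
  push_cast
  rw [one_div_neg_eq_neg_one_div]
  ring

lemma tendsto_pos_of_tendsto {f : ℤ → ℝ}
    (h : Tendsto (fun n : ℤ => 1 / (n : ℝ) * f n) (atTop ⊔ atBot) (𝓝 r)) :
    Tendsto (fun n : ℕ => 1 / (n : ℝ) * f n) atTop (𝓝 r) := by
  simpa using (tendsto_int_iff.1 h).1

/-- A vector off the line of v has a component along w, which dominates in backward time because -r₂
> -r₁; its rate there cannot be that of r₁. Off the line of w, the component along v dominates in
forward time. -/
theorem growthSpace_eq (hvw : wedge v w ≠ 0) (hv : ∀ n, ‖A n v‖ = Real.exp (a n))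
    (hw : ∀ n, ‖A n w‖ = Real.exp (b n))
    (ha : Tendsto (fun n : ℤ => 1 / (n : ℝ) * a n) (atTop ⊔ atBot) (𝓝 r₁))
    (hb : Tendsto (fun n : ℤ => 1 / (n : ℝ) * b n) (atTop ⊔ atBot) (𝓝 r₂)) (hr : r₂ < r₁) :
    growthSpace A r₁ = {x | ∃ c : ℝ, x = c • v} ∧
      growthSpace A r₂ = {x | ∃ c : ℝ, x = c • w} := by
  constructor
  · ext x
    constructor
    · intro hx
      rcases hx with hx | rfl
      swap
      · exact ⟨0, (zero_smul _ _).symm⟩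
      rw [eq_wedge_combination hvw x] at hx ⊢
      set c := wedge x w / wedge v w
      set d := wedge v x / wedge v w
      rcases eq_or_ne d 0 with hd | hd
      · exact ⟨c, by rw [hd, zero_smul, add_zero]⟩
      have := growth_rate_le_of_dominant (abs_pos.2 hd) (abs_nonneg c)
        (fun n : ℕ => by
          have := norm_combination_ge hw hv d c (-(n : ℤ))
          rwa [add_comm (d • w)] at this)
        (tendsto_neg_of_tendsto hb) (tendsto_neg_of_tendsto ha) (neg_lt_neg hr)
        (tendsto_neg_of_tendsto hx)
      linarith
    · rintro ⟨c, rfl⟩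
      exact smul_mem_growthSpace hv ha c
  · ext x
    constructor
    · intro hx
      rcases hx with hx | rfl
      swap
      · exact ⟨0, (zero_smul _ _).symm⟩
      rw [eq_wedge_combination hvw x] at hx ⊢
      set c := wedge x w / wedge v w
      set d := wedge v x / wedge v w
      rcases eq_or_ne c 0 with hc | hc
      · exact ⟨d, by rw [hc, zero_smul, zero_add]⟩
      have := growth_rate_le_of_dominant (abs_pos.2 hc) (abs_nonneg d)
        (fun n : ℕ => norm_combination_ge hv hw c d n)
        (tendsto_pos_of_tendsto ha) (tendsto_pos_of_tendsto hb) hr (tendsto_pos_of_tendsto hx)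
      linarith
    · rintro ⟨c, rfl⟩
      exact smul_mem_growthSpace hw hb c

end GrowthSpace

/-- The growth rates of the singular values, from the growth along two transverse lines. -/
theorem tendsto_log_singularValues {A : ℕ → GL (Fin 2) ℝ} {v w : Plane} (hv1 : ‖v‖ = 1)
    (hw1 : ‖w‖ = 1) (hvw : wedge v w ≠ 0) {a b e : ℕ → ℝ}
    (hv : ∀ n, ‖act (A n) v‖ = Real.exp (a n)) (hw : ∀ n, ‖act (A n) w‖ = Real.exp (b n))
    (hba : ∀ n, b n ≤ a n)
    (hdet : ∀ n, |(A n : Matrix (Fin 2) (Fin 2) ℝ).det| = Real.exp (a n + b n + e n)) {r₁ r₂ : ℝ}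
    (ha : Tendsto (fun n : ℕ => 1 / (n : ℝ) * a n) atTop (𝓝 r₁))
    (hb : Tendsto (fun n : ℕ => 1 / (n : ℝ) * b n) atTop (𝓝 r₂))
    (he : Tendsto (fun n : ℕ => 1 / (n : ℝ) * e n) atTop (𝓝 0)) :
    Tendsto (fun n : ℕ => 1 / (n : ℝ) * Real.log ((act (A n)).singularValues 0)) atTop (𝓝 r₁) ∧
    Tendsto (fun n : ℕ => 1 / (n : ℝ) * Real.log ((act (A n)).singularValues 1)) atTop (𝓝 r₂) := by
  have hW : 0 < |wedge v w| := abs_pos.2 hvw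
  have hpos : ∀ n, 0 < (act (A n)).singularValues 0 := fun n => by
    have h1 := norm_sq_le_two_mul_sq_singularValues (act (A n)) hv1
    rw [hv] at h1
    have h2 := Real.exp_pos (a n)
    refine lt_of_le_of_ne ((act (A n)).singularValues_nonneg 0) fun h => ?_
    rw [← h] at h1
    nlinarith
  -- The image of v bounds the first singular value below, and the images of v and w together bound
  -- it above; as b n ≤ a n, both bounds are multiples of exp (a n) independent of n.
  have hbound : ∀ n, |Real.log ((act (A n)).singularValues 0) - a n| ≤
      |Real.log 2| + |Real.log (8 / |wedge v w| ^ 2)| := by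
    intro n
    have h1 := norm_sq_le_two_mul_sq_singularValues (act (A n)) hv1
    have h2 := sq_singularValues_le (act (A n)) hv1 hw1 hvw
    rw [hv] at h1
    rw [hv, hw] at h2
    have hs := hpos n
    set s := (act (A n)).singularValues 0
    have h3 : s ^ 2 ≤ 8 / |wedge v w| ^ 2 * Real.exp (a n) ^ 2 := by
      refine h2.trans ?_
      have : Real.exp (b n) ≤ Real.exp (a n) := Real.exp_le_exp.2 (hba n)
      calc 2 * ((Real.exp (a n) + Real.exp (b n)) / |wedge v w|) ^ 2
          ≤ 2 * ((Real.exp (a n) + Real.exp (a n)) / |wedge v w|) ^ 2 := by gcongr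
        _ = _ := by field_simp; ring
    have h4 := Real.log_le_log (by positivity) h1
    have h5 := Real.log_le_log (by positivity) h3
    rw [Real.log_pow, Real.log_exp, Real.log_mul two_ne_zero (by positivity), Real.log_pow] at h4
    rw [Real.log_pow, Real.log_mul (by positivity) (by positivity), Real.log_pow,
      Real.log_exp] at h5
    push_cast at h4 h5
    have h6 := abs_le.1 (le_refl |Real.log 2|)
    have h7 := abs_le.1 (le_refl |Real.log (8 / |wedge v w| ^ 2)|)
    rw [abs_le]
    constructor <;> linarith [abs_nonneg (Real.log 2), abs_nonneg (Real.log (8 / |wedge v w| ^ 2))]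
  have hfirst := tendsto_div_of_bounded_sub hbound ha
  refine ⟨hfirst, ?_⟩
  -- The second singular value is |det| divided by the first.
  have h := ((ha.add hb).add he).sub hfirst
  rw [show r₁ + r₂ + 0 - r₁ = r₂ by ring] at h
  refine h.congr fun n => ?_
  have h1 := singularValues_mul (act (A n))
  rw [det_act, hdet] at h1
  have h2 : 0 < (act (A n)).singularValues 1 := by
    have := hpos n
    have h3 := Real.exp_pos (a n + b n + e n)
    rw [← h1] at h3
    exact (mul_pos_iff_of_pos_left this).1 h3
  have h3 := congrArg Real.log h1
  rw [Real.log_mul (hpos n).ne' h2.ne', Real.log_exp] at h3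
  rw [← mul_add, ← mul_add, ← mul_sub]
  congr 1
  linarith

/-! ### Iteration of the cocycle -/

lemma act_mul (g h : GL (Fin 2) ℝ) (v : Plane) : act (g * h) v = act g (act h v) := by
  ext i
  simp only [act, toEuclideanLin_apply_coord, Units.val_mul, Matrix.mul_apply, Fin.sum_univ_two]
  ring

lemma act_one (v : Plane) : act 1 v = v := by
  ext i
  rw [act, toEuclideanLin_apply_coord]
  fin_cases i <;> simp

lemma act_inv_act (g : GL (Fin 2) ℝ) (v : Plane) : act g⁻¹ (act g v) = v := by
  rw [← act_mul, inv_mul_cancel, act_one]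

section Iteration

variable {Ω : Type*} [MeasurableSpace Ω] {T : Ω ≃ᵐ Ω} {F : Ω → GL (Fin 2) ℝ}

lemma cocycle_natCast (n : ℕ) (ω : Ω) : cocycle T F n ω = forwardProduct T F n ω := rfl

lemma cocycle_neg_natCast (n : ℕ) (ω : Ω) :
    cocycle T F (-(n : ℤ)) ω = (forwardProduct T F n (T.symm^[n] ω))⁻¹ := by
  cases n with
  | zero => exact inv_one.symm
  | succ n => rfl

lemma forwardProduct_apply_mul (n : ℕ) (ω : Ω) :
    forwardProduct T F n (T ω) * F ω = forwardProduct T F (n + 1) ω := by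
  induction n with
  | zero => simp [forwardProduct]
  | succ n ih =>
    rw [forwardProduct, mul_assoc, ih]
    rfl

lemma iterate_symm_iterate (n : ℕ) (ω : Ω) : T^[n] (T.symm^[n] ω) = ω :=
  (Function.LeftInverse.iterate T.apply_symm_apply n) ω

lemma cocycle_apply_mul (n : ℤ) (ω : Ω) :
    cocycle T F n (T ω) * F ω = cocycle T F (n + 1) ω := by
  obtain ⟨n, rfl | rfl⟩ := n.eq_nat_or_neg
  · exact forwardProduct_apply_mul n ω
  · cases n with
    | zero => exact forwardProduct_apply_mul 0 ω
    | succ m =>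
      rw [show (-((m + 1 : ℕ) : ℤ)) + 1 = -(m : ℤ) by push_cast; ring, cocycle_neg_natCast,
        cocycle_neg_natCast, Function.iterate_succ_apply, T.symm_apply_apply, forwardProduct,
        iterate_symm_iterate, mul_inv_rev, mul_assoc, inv_mul_cancel, mul_one]

lemma act_forwardProduct {v : Ω → Plane} {κ : Ω → ℝ} {ω : Ω}
    (h : ∀ n : ℕ, act (F (T^[n] ω)) (v (T^[n] ω)) = Real.exp (κ (T^[n] ω)) • v (T (T^[n] ω)))
    (n : ℕ) : act (forwardProduct T F n ω) (v ω) =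
      Real.exp (birkhoffSum T κ n ω) • v (T^[n] ω) := by
  induction n with
  | zero => simp [forwardProduct, act_one]
  | succ n ih =>
    rw [forwardProduct, act_mul, ih, map_smul, h, smul_smul, ← Real.exp_add, birkhoffSum_succ,
      Function.iterate_succ_apply']

lemma birkhoffSum_iterate_symm (κ : Ω → ℝ) (n : ℕ) (ω : Ω) :
    birkhoffSum T κ n (T.symm^[n] ω) = birkhoffSum T.symm κ n (T.symm ω) := by
  induction n with
  | zero => simp
  | succ n ih =>
    rw [birkhoffSum_succ', birkhoffSum_succ, Function.iterate_succ_apply', T.apply_symm_apply, ih,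
      ← Function.iterate_succ_apply, Function.iterate_succ_apply', add_comm]

/-- The logarithmic stretch along the orbit, for positive and negative times. -/
def orbitSum (T : Ω ≃ᵐ Ω) (κ : Ω → ℝ) (ω : Ω) : ℤ → ℝ
  | Int.ofNat n => birkhoffSum T κ n ω
  | Int.negSucc n => -birkhoffSum T.symm κ (n + 1) (T.symm ω)

lemma orbitSum_natCast (κ : Ω → ℝ) (ω : Ω) (n : ℕ) :
    orbitSum T κ ω n = birkhoffSum T κ n ω := rfl

lemma orbitSum_neg_natCast (κ : Ω → ℝ) (ω : Ω) (n : ℕ) :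
    orbitSum T κ ω (-(n : ℤ)) = -birkhoffSum T.symm κ n (T.symm ω) := by
  cases n with
  | zero => simp [orbitSum]
  | succ n => rfl

/-- For negative times, the product that starts at T^(-n) ω carries v there to a multiple of v ω,
and is then inverted. This is why equivariance is needed along the forward orbits of all T^(-m) ω.
-/
lemma norm_act_cocycle {v : Ω → Plane} {κ : Ω → ℝ} {ω : Ω} (hv : ∀ ω, ‖v ω‖ = 1)
    (h : ∀ n : ℕ, act (F (T^[n] ω)) (v (T^[n] ω)) = Real.exp (κ (T^[n] ω)) • v (T (T^[n] ω)))
    (h' : ∀ m n : ℕ, act (F (T^[n] (T.symm^[m] ω))) (v (T^[n] (T.symm^[m] ω))) =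
      Real.exp (κ (T^[n] (T.symm^[m] ω))) • v (T (T^[n] (T.symm^[m] ω)))) (n : ℤ) :
    ‖act (cocycle T F n ω) (v ω)‖ = Real.exp (orbitSum T κ ω n) := by
  obtain ⟨n, rfl | rfl⟩ := n.eq_nat_or_neg
  · rw [cocycle_natCast, act_forwardProduct h, norm_smul, hv, mul_one, Real.norm_eq_abs,
      abs_of_pos (Real.exp_pos _), orbitSum_natCast]
  · have h1 := act_forwardProduct (h' n) n
    rw [iterate_symm_iterate, birkhoffSum_iterate_symm] at h1
    have h2 : v ω = Real.exp (-birkhoffSum T.symm κ n (T.symm ω)) •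
        act (forwardProduct T F n (T.symm^[n] ω)) (v (T.symm^[n] ω)) := by
      rw [h1, smul_smul, ← Real.exp_add, neg_add_cancel, Real.exp_zero, one_smul]
    rw [cocycle_neg_natCast, orbitSum_neg_natCast]
    conv_lhs => rw [h2]
    rw [map_smul, act_inv_act, norm_smul, hv, mul_one, Real.norm_eq_abs,
      abs_of_pos (Real.exp_pos _)]

end Iteration

/-! ### Growth along almost every orbit, and the two halves of the theorem -/

section Ergodic

variable {Ω : Type*} [MeasurableSpace Ω] {μ : Measure Ω} [IsProbabilityMeasure μ] {T : Ω ≃ᵐ Ω}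

omit [IsProbabilityMeasure μ] in
lemma ae_forall_iterate {f : Ω → Ω} (hf : MeasurePreserving f μ μ) {p : Ω → Prop}
    (h : ∀ᵐ ω ∂μ, p ω) : ∀ᵐ ω ∂μ, ∀ n : ℕ, p (f^[n] ω) :=
  ae_all_iff.2 fun n => (hf.iterate n).quasiMeasurePreserving.ae h

lemma ae_tendsto_orbitSum (hT : Ergodic T μ) {κ : Ω → ℝ} (hκ : Measurable κ) {C : ℝ}
    (hC : ∀ ω, |κ ω| ≤ C) :
    ∀ᵐ ω ∂μ, Tendsto (fun n : ℤ => 1 / (n : ℝ) * orbitSum T κ ω n) (atTop ⊔ atBot)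
      (𝓝 (∫ ω, κ ω ∂μ)) := by
  filter_upwards [ae_tendsto_birkhoffSum hT hκ hC,
    hT.symm.toMeasurePreserving.quasiMeasurePreserving.ae
      (ae_tendsto_birkhoffSum hT.symm hκ hC)] with ω h1 h2
  rw [tendsto_int_iff]
  constructor
  · simpa [orbitSum_natCast] using h1
  · refine h2.congr fun n => ?_
    rw [orbitSum_neg_natCast]
    push_cast
    rw [one_div_neg_eq_neg_one_div]
    ring

/-- A function with bounded increments along the orbits grows sublinearly along almost every
orbit. -/
lemma ae_tendsto_coboundary (hT : Ergodic T μ) {f : Ω → ℝ} (hf : Measurable f) {C M : ℝ}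
    (hC : ∀ᵐ ω ∂μ, |f (T ω) - f ω| ≤ C) (hM : μ {ω | |f ω| ≤ M} ≠ 0) :
    ∀ᵐ ω ∂μ, Tendsto (fun n : ℕ => 1 / (n : ℝ) * (f (T^[n] ω) - f ω)) atTop (𝓝 0) := by
  have hD : MeasurableSet {ω | |f (T ω) - f ω| ≤ C} :=
    measurableSet_le (continuous_abs.measurable.comp ((hf.comp T.measurable).sub hf))
      measurable_const
  let g : Ω → ℝ := Set.indicator {ω | |f (T ω) - f ω| ≤ C} fun ω => f (T ω) - f ω
  have hg : Measurable g := ((hf.comp T.measurable).sub hf).indicator hD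
  have hgC : ∀ ω, |g ω| ≤ |C| := fun ω => by
    by_cases h : ω ∈ {ω | |f (T ω) - f ω| ≤ C}
    · simp only [g, Set.indicator_of_mem h]
      exact le_trans h (le_abs_self C)
    · simp only [g, Set.indicator_of_notMem h, abs_zero, abs_nonneg]
  have hP : MeasurableSet {ω | |f ω| ≤ M} :=
    measurableSet_le (continuous_abs.measurable.comp hf) measurable_const
  filter_upwards [ae_tendsto_birkhoffSum hT hg hgC,
    ae_forall_iterate hT.toMeasurePreserving hC,
    ae_forall_iterate hT.toMeasurePreserving (ae_exists_iterate_mem hT hP hM)] with ω h1 h2 h3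
  have hsum : ∀ n, birkhoffSum T g n ω = f (T^[n] ω) - f ω := by
    intro n
    induction n with
    | zero => simp
    | succ n ih =>
      have h4 : g (T^[n] ω) = f (T (T^[n] ω)) - f (T^[n] ω) :=
        Set.indicator_of_mem (show T^[n] ω ∈ {ω | |f (T ω) - f ω| ≤ C} from h2 n) _
      rw [birkhoffSum_succ, ih, h4, Function.iterate_succ_apply']
      ring
  simp_rw [hsum] at h1
  -- f need not be integrable, so its increment is not known to have mean zero. But the averages
  -- converge to the mean of g, and at the infinitely many visits to {|f| ≤ M} they are O(1/n).
  suffices h : ∫ ω, g ω ∂μ = 0 by rwa [h] at h1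
  have hsmall : Tendsto (fun n : ℕ => 1 / (n : ℝ) * (M + |f ω|)) atTop (𝓝 0) := by
    simpa using tendsto_one_div_atTop_nhds_zero_nat.mul_const (M + |f ω|)
  have hfreq : ∃ᶠ n : ℕ in atTop,
      |1 / (n : ℝ) * (f (T^[n] ω) - f ω)| ≤ 1 / (n : ℝ) * (M + |f ω|) := by
    rw [frequently_atTop]
    intro N
    obtain ⟨n, hn⟩ := h3 N
    refine ⟨n + N, by omega, ?_⟩
    rw [← Function.iterate_add_apply] at hn
    rw [abs_mul, abs_of_nonneg (by positivity : (0 : ℝ) ≤ 1 / ((n + N : ℕ) : ℝ))]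
    refine mul_le_mul_of_nonneg_left ((abs_sub _ _).trans ?_) (by positivity)
    have : |f (T^[n + N] ω)| ≤ M := hn
    linarith
  have := le_of_tendsto_of_tendsto_of_frequently h1.abs hsmall hfreq
  exact abs_nonpos_iff.1 this

/-! ### Existence of the cocycle -/

/-- A family of line pairs whose angles change by a bounded factor along the orbits consists of the
Oseledets spaces of a bounded cocycle with given exponents. -/
theorem exists_cocycle_with_exponents (hT : Ergodic T μ) {r₁ r₂ : ℝ} (hr : r₂ < r₁)
    {E : Ω → LinePairs} (hE : Measurable E) {K : ℝ} (hK0 : 0 < K)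
    (hK : ∀ᵐ ω ∂μ, sinAngle (E (T ω)) ≤ K * sinAngle (E ω) ∧
      sinAngle (E ω) ≤ K * sinAngle (E (T ω))) :
    ∃ F : Ω → GL (Fin 2) ℝ, Measurable[_, borel (GL (Fin 2) ℝ)] F ∧ IsBoundedMap F ∧
      HasLyapunovExponents μ T F r₁ r₂ ∧
      ∀ᵐ ω ∂μ, ((E ω).1.1.line : Set Plane) = oseledetsSpace T F r₁ ω ∧
        ((E ω).1.2.line : Set Plane) = oseledetsSpace T F r₂ ω := by
  obtain ⟨N, hN⟩ : ∃ n : ℕ, μ {ω | 1 / ((n : ℝ) + 1) ≤ sinAngle (E ω)} ≠ 0 := by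
    by_contra! h
    have h1 := measure_iUnion_null h
    have h2 : (⋃ n : ℕ, {ω | 1 / ((n : ℝ) + 1) ≤ sinAngle (E ω)}) = Set.univ :=
      Set.eq_univ_of_forall fun ω => Set.mem_iUnion.2
        ((exists_nat_one_div_lt (sinAngle_pos (E ω))).imp fun _ h => h.le)
    rw [h2, measure_univ] at h1
    exact one_ne_zero h1
  set δ : ℝ := 1 / ((N : ℝ) + 1)
  have hδ : 0 < δ := by positivity
  set P : Set Ω := {ω | δ ≤ sinAngle (E ω)}
  have hPm : MeasurableSet P := measurableSet_le measurable_const (measurable_sinAngle.comp hE)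
  have hP : 0 < μ.real P := ENNReal.toReal_pos hN (measure_ne_top _ _)
  -- Stretching acts only on P, so this rate there gives the average r.
  let c : ℝ → ℝ := fun r => r / μ.real P
  let κ : ℝ → Ω → ℝ := fun r => P.indicator fun _ => c r
  have hκ : ∀ r, Measurable (κ r) := fun r => measurable_const.indicator hPm
  have hκC : ∀ r ω, |κ r ω| ≤ |c r| := fun r ω => by
    by_cases h : ω ∈ P
    · simp only [κ, Set.indicator_of_mem h, le_refl]
    · simp only [κ, Set.indicator_of_notMem h, abs_zero, abs_nonneg]
  have hκint : ∀ r, ∫ ω, κ r ω ∂μ = r := fun r => by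
    simp only [κ, integral_indicator hPm, setIntegral_const, smul_eq_mul, c]
    exact mul_div_cancel₀ r hP.ne'
  obtain ⟨F, hFm, hFb, hF⟩ := exists_cocycle_of_linePairs hE hK0 hK hδ (c r₁) (c r₂)
  have hlim : ∀ r, ∀ᵐ ω ∂μ, Tendsto (fun n : ℤ => 1 / (n : ℝ) * orbitSum T (κ r) ω n)
      (atTop ⊔ atBot) (𝓝 r) := fun r => by
    have := ae_tendsto_orbitSum hT (hκ r) (hκC r)
    rwa [hκint] at this
  have hforw := ae_forall_iterate hT.toMeasurePreserving hF
  have hback := ae_forall_iterate hT.symm.toMeasurePreserving hforw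
  have hlog : ∀ᵐ ω ∂μ, Tendsto (fun n : ℕ => 1 / (n : ℝ) *
      (Real.log (sinAngle (E (T^[n] ω))) - Real.log (sinAngle (E ω)))) atTop (𝓝 0) := by
    refine ae_tendsto_coboundary (f := fun ω => Real.log (sinAngle (E ω)))
      (C := Real.log K) (M := -Real.log δ) hT
      (Real.measurable_log.comp (measurable_sinAngle.comp hE)) ?_ ?_
    · filter_upwards [hK] with ω ⟨h1, h2⟩
      have h3 := Real.log_le_log (sinAngle_pos _) h1
      have h4 := Real.log_le_log (sinAngle_pos _) h2
      rw [Real.log_mul hK0.ne' (sinAngle_pos _).ne'] at h3 h4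
      rw [abs_le]
      constructor <;> linarith
    · refine fun h => hN (measure_mono_null (fun ω hω => ?_) h)
      have h1 := Real.log_le_log hδ (show δ ≤ sinAngle (E ω) from hω)
      have h2 := Real.log_nonpos (sinAngle_pos (E ω)).le (sinAngle_le_one _)
      change |Real.log (sinAngle (E ω))| ≤ -Real.log δ
      rw [abs_of_nonpos h2]
      linarith
  refine ⟨F, hFm, hFb, ?_, ?_⟩
  · filter_upwards [hforw, hlim r₁, hlim r₂, hlog] with ω h1 h2 h3 h4
    have hv := act_forwardProduct (v := fun ω => (E ω).1.1.unit) (κ := κ r₁) fun n => (h1 n).1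
    have hw := act_forwardProduct (v := fun ω => acuteUnit (E ω)) (κ := κ r₂) fun n => (h1 n).2
    refine tendsto_log_singularValues (A := fun n => forwardProduct T F n ω)
      (E ω).1.1.norm_unit (norm_acuteUnit (E ω)) (wedge_acuteUnit_ne_zero (E ω))
      (a := fun n => birkhoffSum T (κ r₁) n ω) (b := fun n => birkhoffSum T (κ r₂) n ω)
      (fun n => ?_) (fun n => ?_) (fun n => ?_) (fun n => ?_) (tendsto_pos_of_tendsto h2)
      (tendsto_pos_of_tendsto h3) h4
    · rw [hv, norm_smul, RP1.norm_unit, mul_one, Real.norm_eq_abs, abs_of_pos (Real.exp_pos _)]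
    · rw [hw, norm_smul, norm_acuteUnit, mul_one, Real.norm_eq_abs, abs_of_pos (Real.exp_pos _)]
    · refine Finset.sum_le_sum fun k _ => ?_
      exact Set.indicator_le_indicator ((div_lt_div_iff_of_pos_right hP).2 hr).le
    · have h5 := wedge_toEuclideanLin (forwardProduct T F n ω : Matrix (Fin 2) (Fin 2) ℝ)
        (E ω).1.1.unit (acuteUnit (E ω))
      have hv' := hv n
      have hw' := hw n
      rw [act] at hv' hw'
      rw [hv', hw', wedge_smul_smul] at h5
      have h6 := congrArg abs h5
      rw [abs_mul, abs_mul, abs_mul, abs_wedge_acuteUnit, abs_wedge_acuteUnit,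
        abs_of_pos (Real.exp_pos _), abs_of_pos (Real.exp_pos _), ← Real.exp_add] at h6
      rw [Real.exp_add, Real.exp_sub, Real.exp_log (sinAngle_pos _),
        Real.exp_log (sinAngle_pos _), ← mul_div_assoc, eq_div_iff (sinAngle_pos _).ne']
      exact h6.symm
  · filter_upwards [hforw, hback, hlim r₁, hlim r₂] with ω h1 h2 h3 h4
    have hv := norm_act_cocycle (v := fun ω => (E ω).1.1.unit) (κ := κ r₁)
      (fun ω => (E ω).1.1.norm_unit) (fun n => (h1 n).1) (fun m n => (h2 m n).1)
    have hw := norm_act_cocycle (v := fun ω => acuteUnit (E ω)) (κ := κ r₂)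
      (fun ω => norm_acuteUnit (E ω)) (fun n => (h1 n).2) (fun m n => (h2 m n).2)
    have h5 := growthSpace_eq (A := fun n => act (cocycle T F n ω))
      (wedge_acuteUnit_ne_zero (E ω)) hv hw h3 h4 hr
    constructor
    · refine Eq.trans ?_ h5.1.symm
      ext x
      exact (E ω).1.1.mem_line_iff x
    · refine Eq.trans ?_ h5.2.symm
      ext x
      refine ((E ω).1.2.mem_line_iff x).trans ?_
      rcases acuteUnit_eq_or (E ω) with h | h
      · rw [h]
        rfl
      · rw [h]
        exact ⟨fun ⟨c, hc⟩ => ⟨-c, by rw [hc, neg_smul_neg]⟩,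
          fun ⟨c, hc⟩ => ⟨-c, by rw [hc, neg_smul, smul_neg]⟩⟩

/-! ### Bounded gap of the joint distribution -/

omit [IsProbabilityMeasure μ] in
-- By the cocycle identity the new orbit of vectors is the old one shifted by one step, and (n + 1)
-- / n → 1.
lemma act_mem_oseledetsSpace {F : Ω → GL (Fin 2) ℝ} {r : ℝ} {ω : Ω} {x : Plane}
    (hx : x ∈ oseledetsSpace T F r ω) : act (F ω) x ∈ oseledetsSpace T F r (T ω) := by
  rcases hx with hx | rfl
  swap
  · exact Or.inr (map_zero _)
  left
  have hshift : Tendsto (fun n : ℤ => n + 1) (atTop ⊔ atBot) (atTop ⊔ atBot) :=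
    tendsto_sup.2 ⟨(tendsto_atTop_add_const_right _ 1 tendsto_id).mono_right le_sup_left,
      (tendsto_atBot_add_const_right _ 1 tendsto_id).mono_right le_sup_right⟩
  have h0 : Tendsto (fun n : ℤ => 1 / (n : ℝ)) (atTop ⊔ atBot) (𝓝 0) := by
    rw [tendsto_int_iff]
    have h1 := tendsto_one_div_atTop_nhds_zero_nat (𝕜 := ℝ)
    refine ⟨by simpa using h1, ?_⟩
    simpa using h1.neg
  have h1 := ((h0.const_add 1).mul (hx.comp hshift))
  rw [add_zero, one_mul] at h1
  refine h1.congr' ?_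
  have hne : ∀ k : ℤ, ∀ᶠ n : ℤ in atTop ⊔ atBot, n ≠ k := fun k =>
    eventually_sup.2 ⟨eventually_ne_atTop k, eventually_ne_atBot k⟩
  filter_upwards [hne 0, hne (-1)] with n hn0 hn1
  have hn0' : (n : ℝ) ≠ 0 := by exact_mod_cast hn0
  have hn1' : (n : ℝ) + 1 ≠ 0 := by
    have : n + 1 ≠ 0 := fun h => hn1 (by omega)
    exact_mod_cast this
  simp only [Function.comp_apply]
  rw [← act_mul, cocycle_apply_mul]
  push_cast
  field_simp

omit [MeasurableSpace Ω] in
-- The entries and the inverse of the determinant are continuous, hence bounded on the compact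
-- closure of the image.
lemma exists_norm_act_le_and_det_ge {F : Ω → GL (Fin 2) ℝ} (hF : IsBoundedMap F) :
    ∃ M d : ℝ, 0 < M ∧ 0 < d ∧ (∀ ω v, ‖v‖ = 1 → ‖act (F ω) v‖ ≤ M) ∧
      ∀ ω, d ≤ |(F ω : Matrix (Fin 2) (Fin 2) ℝ).det| := by
  have hval : Continuous (Units.val : GL (Fin 2) ℝ → Matrix (Fin 2) (Fin 2) ℝ) :=
    isEmbedding_coe_GL.continuous
  have hmem : ∀ ω, F ω ∈ closure (Set.range F) := fun ω => subset_closure ⟨ω, rfl⟩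
  have hentry : ∀ i j : Fin 2, ∃ C, ∀ ω, |(F ω : Matrix (Fin 2) (Fin 2) ℝ) i j| ≤ C := by
    intro i j
    obtain ⟨C, hC⟩ := hF.exists_bound_of_continuousOn
      (f := fun g : GL (Fin 2) ℝ => (g : Matrix (Fin 2) (Fin 2) ℝ) i j)
      ((hval.matrix_elem i j).continuousOn)
    exact ⟨C, fun ω => hC _ (hmem ω)⟩
  choose C hC using hentry
  have hdet0 : ∀ g : GL (Fin 2) ℝ, (g : Matrix (Fin 2) (Fin 2) ℝ).det ≠ 0 := fun g =>
    ((Matrix.isUnit_iff_isUnit_det _).1 g.isUnit).ne_zero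
  obtain ⟨D, hD⟩ := hF.exists_bound_of_continuousOn
    (f := fun g : GL (Fin 2) ℝ => ((g : Matrix (Fin 2) (Fin 2) ℝ).det)⁻¹)
    ((hval.matrix_det.inv₀ hdet0).continuousOn)
  refine ⟨|C 0 0| + |C 0 1| + |C 1 0| + |C 1 1| + 1, (|D| + 1)⁻¹, by positivity, by positivity,
    fun ω v hv => ?_, fun ω => ?_⟩
  · have hle : ∀ i, |act (F ω) v i| ≤ |C i 0| + |C i 1| := by
      intro i
      rw [act, toEuclideanLin_apply_coord]
      refine (abs_add_le _ _).trans ?_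
      rw [abs_mul, abs_mul]
      have h0 := mul_le_mul ((hC i 0 ω).trans (le_abs_self _)) (abs_coord_le_one hv 0)
        (abs_nonneg _) (abs_nonneg _)
      have h1 := mul_le_mul ((hC i 1 ω).trans (le_abs_self _)) (abs_coord_le_one hv 1)
        (abs_nonneg _) (abs_nonneg _)
      linarith
    have h2 := norm_sq_plane (act (F ω) v)
    rw [← sq_abs (act (F ω) v 0), ← sq_abs (act (F ω) v 1)] at h2
    have h3 : ‖act (F ω) v‖ ≤ |act (F ω) v 0| + |act (F ω) v 1| := by
      refine abs_le_of_sq_le_sq' ?_ (by positivity) |>.2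
      nlinarith [mul_nonneg (abs_nonneg (act (F ω) v 0)) (abs_nonneg (act (F ω) v 1))]
    linarith [hle 0, hle 1]
  · have h1 := hD _ (hmem ω)
    rw [norm_inv, Real.norm_eq_abs] at h1
    have h2 : 0 < |(F ω : Matrix (Fin 2) (Fin 2) ℝ).det| := abs_pos.2 (hdet0 _)
    rw [inv_le_comm₀ (by positivity) h2]
    linarith [le_abs_self D]

/-- The sine is multiplied at each step by |det F| over the product of the two stretches, hence by
at least d / M². A wider gap cannot be crossed downwards, and ergodicity leaves one of its sides
null. -/
theorem hasBoundedGap_of_oseledetsJointDistribution (hT : Ergodic T μ) {r₁ r₂ : ℝ}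
    {η : Measure LinePairs} [IsProbabilityMeasure η] {F : Ω → GL (Fin 2) ℝ}
    (hF : IsBoundedMap F) (hη : OseledetsJointDistribution μ T F r₁ r₂ η) : HasBoundedGap η := by
  intro hgap
  obtain ⟨M, d, hM, hd, hnorm, hdet⟩ := exists_norm_act_le_and_det_ge hF
  obtain ⟨E, hE, hline, rfl⟩ := hη
  -- The bound d / M² forbids the passage from B to A, and the bound 1 makes A and B disjoint.
  obtain ⟨A, B, hA, hB, hA0, hB0, hAB, hsin⟩ := hgap (min 1 (d / M ^ 2)) (by positivity)
  have hTqmp := hT.toMeasurePreserving.quasiMeasurePreserving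
  have hratio : ∀ᵐ ω ∂μ, d / M ^ 2 * sinAngle (E ω) ≤ sinAngle (E (T ω)) := by
    filter_upwards [hline, hTqmp.ae hline] with ω h1 h2
    have hv : act (F ω) (E ω).1.1.unit ∈ (E (T ω)).1.1.line := by
      have : (E ω).1.1.unit ∈ oseledetsSpace T F r₁ ω := by
        rw [← h1.1]
        exact ((E ω).1.1.mem_line_iff _).2 ⟨1, (one_smul _ _).symm⟩
      have := act_mem_oseledetsSpace this
      rwa [← h2.1] at this
    have hw : act (F ω) (E ω).1.2.unit ∈ (E (T ω)).1.2.line := by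
      have : (E ω).1.2.unit ∈ oseledetsSpace T F r₂ ω := by
        rw [← h1.2]
        exact ((E ω).1.2.mem_line_iff _).2 ⟨1, (one_smul _ _).symm⟩
      have := act_mem_oseledetsSpace this
      rwa [← h2.2] at this
    obtain ⟨x, hx⟩ := (RP1.mem_line_iff _ _).1 hv
    obtain ⟨y, hy⟩ := (RP1.mem_line_iff _ _).1 hw
    have hx' := hnorm ω _ (E ω).1.1.norm_unit
    have hy' := hnorm ω _ (E ω).1.2.norm_unit
    rw [hx, norm_smul, RP1.norm_unit, mul_one, Real.norm_eq_abs] at hx'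
    rw [hy, norm_smul, RP1.norm_unit, mul_one, Real.norm_eq_abs] at hy'
    have h3 := wedge_toEuclideanLin (F ω : Matrix (Fin 2) (Fin 2) ℝ) (E ω).1.1.unit (E ω).1.2.unit
    rw [act] at hx hy
    rw [hx, hy, wedge_smul_smul] at h3
    have h4 := congrArg abs h3
    rw [abs_mul, abs_mul, abs_mul] at h4
    change |x| * |y| * sinAngle (E (T ω)) = _ * sinAngle (E ω) at h4
    have h5 : d * sinAngle (E ω) ≤ M ^ 2 * sinAngle (E (T ω)) := by
      calc d * sinAngle (E ω) ≤ |(F ω : Matrix (Fin 2) (Fin 2) ℝ).det| * sinAngle (E ω) :=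
            mul_le_mul_of_nonneg_right (hdet ω) (sinAngle_pos _).le
        _ = |x| * |y| * sinAngle (E (T ω)) := h4.symm
        _ ≤ M * M * sinAngle (E (T ω)) := by
            have := (sinAngle_pos (E (T ω))).le
            gcongr
        _ = M ^ 2 * sinAngle (E (T ω)) := by ring
    rw [div_mul_eq_mul_div, div_le_iff₀ (by positivity)]
    linarith
  have hcover : ∀ᵐ ω ∂μ, E ω ∈ A ∪ B := by
    have : ∀ᵐ p ∂(μ.map E), p ∈ A ∪ B := by
      rw [ae_iff]
      exact (prob_compl_eq_zero_iff (hA.union hB)).2 hAB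
    exact ae_of_ae_map hE.aemeasurable this
  have hinv : (E ⁻¹' B : Set Ω) ≤ᵐ[μ] T ⁻¹' (E ⁻¹' B) := by
    filter_upwards [hratio, hTqmp.ae hcover] with ω h1 h2 h3
    refine h2.resolve_left fun h4 => ?_
    have h5 := hsin _ h4 _ h3
    rw [sin_pairAngle, sin_pairAngle] at h5
    have h6 : min 1 (d / M ^ 2) * sinAngle (E ω) ≤ d / M ^ 2 * sinAngle (E ω) :=
      mul_le_mul_of_nonneg_right (min_le_right _ _) (sinAngle_pos _).le
    linarith
  rw [Measure.map_apply hE hA] at hA0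
  rw [Measure.map_apply hE hB] at hB0
  rcases hT.ae_empty_or_univ_of_ae_le_preimage (hE hB).nullMeasurableSet hinv with h | h
  · exact hB0.ne' (ae_eq_empty.1 h)
  · refine hA0.ne' (measure_mono_null (fun ω hωA => ?_) (ae_eq_univ.1 h))
    intro hωB
    have h5 := hsin _ hωA _ hωB
    rw [sin_pairAngle] at h5
    have h6 : min 1 (d / M ^ 2) * sinAngle (E ω) ≤ 1 * sinAngle (E ω) :=
      mul_le_mul_of_nonneg_right (min_le_left _ _) (sinAngle_pos _).le
    linarith

end Ergodic

end Oseledets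

end

/-- A probability measure on the pairs of distinct lines that has bounded gap is the joint
distribution of the Oseledets spaces of a bounded measurable cocycle with the prescribed exponents;
conversely, only measures with bounded gap arise in this way. -/
theorem theorem1p4 {Ω : Type*} [MeasurableSpace Ω] (μ : Measure Ω) [IsProbabilityMeasure μ]
    (hμ : Oseledets.IsNonatomicLebesgueSpace μ) (T : Ω ≃ᵐ Ω) (hT : Ergodic T μ)
    (r₁ r₂ : ℝ) (hr : r₂ < r₁)
    (η : Measure Oseledets.LinePairs) [IsProbabilityMeasure η] :
    (Oseledets.HasBoundedGap η →
      ∃ F : Ω → GL (Fin 2) ℝ,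
        Measurable[_, borel (GL (Fin 2) ℝ)] F ∧
        Oseledets.IsBoundedMap F ∧
        Oseledets.HasLyapunovExponents μ T F r₁ r₂ ∧
        Oseledets.OseledetsJointDistribution μ T F r₁ r₂ η) ∧
    (∀ F : Ω → GL (Fin 2) ℝ,
        Measurable[_, borel (GL (Fin 2) ℝ)] F →
        Oseledets.IsBoundedMap F →
        Oseledets.HasLyapunovExponents μ T F r₁ r₂ →
        Oseledets.OseledetsJointDistribution μ T F r₁ r₂ η →
        Oseledets.HasBoundedGap η) := by

  refine ⟨fun hη => ?_, fun F _ hF _ hη =>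
    Oseledets.hasBoundedGap_of_oseledetsJointDistribution hT hF hη⟩
  obtain ⟨E, hE, hEη, K, hK0, hK⟩ := Oseledets.exists_linePairs_of_hasBoundedGap hμ hT hη
  obtain ⟨F, hFm, hFb, hFexp, hFline⟩ := Oseledets.exists_cocycle_with_exponents hT hr hE hK0 hK
  exact ⟨F, hFm, hFb, hFexp, E, hE, hFline, hEη⟩
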